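/- Let $N\ge 1$, $0<\lambda\le\Lambda$. For a real symmetric $N\times N$ matrix $X$ with eigenvalues $\lambda_1,\dots,\lambda_N$ (counted with multiplicity) let $$\mathcal M^-(X)=\Lambda\sum_{\lambda_i<0}\lambda_i+\lambda\sum_{\lambda_i>0}\lambda_i,\qquad \mathcal M^+(X)=\lambda\sum_{\lambda_i<0}\lambda_i+\Lambda\sum_{\lambda_i>0}\lambda_i .$$ Let $\Omega\subset\mathbb R^N$ be a (possibly unbounded) open set of class $C^2$ with boundary $\Gamma$. For each $\varepsilon>0$ let $u^\varepsilon_\pm$ be the bounded viscosity solution, continuous on $\overline\Omega$, of $$-\varepsilon^2\mathcal M^\pm(\nabla^2u)+u=0\ \text{ in }\Omega,\qquad u=1\ \text{ on }\Gamma .$$ Let $x\in\Omega$, $R>0$ and $z_x\in\Gamma$ be such that $\overline{B_R(x)}\cap(\mathbb R^N\setminus\Omega)=\{z_x\}$, and suppose that the principal curvatures of $\Gamma$ at $z_x$ (with respect to the inner normal, so that those of a ball of radius $r$ are $1/r$) satisfy $\kappa_j(z_x)<1/R$ for $j=1,\dots,N-1$. Put $\Pi_0(z_x)=\prod_{j=1}^{N-1}[1-R\,\kappa_j(z_x)]$.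 For $1<q\le\infty$ let $\mu^\pm_{q,\varepsilon}(x)$ be the $q$-mean of $u^\varepsilon_\pm$ on $B_R(x)$, i.e. the unique minimum point of $\mathbb R\ni\mu\mapsto\|u^\varepsilon_\pm-\mu\|_{L^q(B_R(x))}$. Then, for every $1<q<\infty$, $$\lim_{\varepsilon\to0^+}\Big(\frac R\varepsilon\Big)^{\frac{N+1}{2(q-1)}}\mu^-_{q,\varepsilon}(x)=c_{N,q}\Big\{\frac{\Pi_0(z_x)}{\lambda^{\frac{N+1}2}}\Big\}^{-\frac1{2(q-1)}},\qquad \lim_{\varepsilon\to0^+}\Big(\frac R\varepsilon\Big)^{\frac{N+1}{2(q-1)}}\mu^+_{q,\varepsilon}(x)=c_{N,q}\Big\{\frac{\Pi_0(z_x)}{\Lambda^{\frac{N+1}2}}\Big\}^{-\frac1{2(q-1)}},$$ where $$c_{N,q}=\left[\frac{2^{-\frac{N+1}2}\,N!}{(q-1)^{\frac{N+1}2}\,\Gamma\!\left(\frac{N+1}2\right)}\right]^{\frac1{q-1}}$$ and $\Gamma(\cdot)$ in the last formula is Euler's gamma function. For $q=\infty$, $$\lim_{\varepsilon\to0^+}\mu^\pm_{\infty,\varepsilon}(x)=\frac12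 .$$ -/

import Mathlib

open Filter Topology MeasureTheory Set
open scoped ENNReal

noncomputable section

namespace PucciMeans

/-- The Euclidean space `ℝᴺ`. -/
abbrev E (N : ℕ) : Type := EuclideanSpace ℝ (Fin N)

/-- The space of real symmetric `N × N` matrices. -/
abbrev SymMat (N : ℕ) : Type := {X : Matrix (Fin N) (Fin N) ℝ // X.IsHermitian}

/-- Pucci's minimal operator: `Λ` times the sum of the negative eigenvalues plus `λ` times the
sum of the positive ones, eigenvalues being counted with multiplicity. -/
def pucciMinus {N : ℕ} (lam Lam : ℝ) (X : SymMat N) : ℝ :=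
  Lam * (∑ i with X.2.eigenvalues i < 0, X.2.eigenvalues i) +
    lam * (∑ i with 0 < X.2.eigenvalues i, X.2.eigenvalues i)

/-- Pucci's maximal operator: `λ` times the sum of the negative eigenvalues plus `Λ` times the
sum of the positive ones, eigenvalues being counted with multiplicity. -/
def pucciPlus {N : ℕ} (lam Lam : ℝ) (X : SymMat N) : ℝ :=
  lam * (∑ i with X.2.eigenvalues i < 0, X.2.eigenvalues i) +
    Lam * (∑ i with 0 < X.2.eigenvalues i, X.2.eigenvalues i)

/-- The matrix of second partial derivatives of `φ` at `x`. -/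
def hessianMatrix {N : ℕ} (φ : E N → ℝ) (x : E N) : Matrix (Fin N) (Fin N) ℝ :=
  Matrix.of fun i j =>
    fderiv ℝ (fderiv ℝ φ) x (EuclideanSpace.single i 1) (EuclideanSpace.single j 1)

theorem hessianMatrix_isHermitian {N : ℕ} {φ : E N → ℝ} {x : E N} (hφ : ContDiffAt ℝ 2 φ x) :
    (hessianMatrix φ x).IsHermitian := by
  have h : IsSymmSndFDerivAt ℝ φ x := hφ.isSymmSndFDerivAt (by simp)
  ext i j
  simpa [hessianMatrix] using h (EuclideanSpace.single j 1) (EuclideanSpace.single i 1)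

/-- The Hessian `∇²φ(x)` of a function that is `C²` near `x`, as a symmetric matrix. -/
def hessian {N : ℕ} (φ : E N → ℝ) (x : E N) (hφ : ContDiffAt ℝ 2 φ x) : SymMat N :=
  ⟨hessianMatrix φ x, hessianMatrix_isHermitian hφ⟩

/-- `u` is a viscosity sub-solution of `-ε² M(∇²u) + u = 0` in `Ω`. -/
def IsViscositySubsolution {N : ℕ} (M : SymMat N → ℝ) (ε : ℝ) (Ω : Set (E N)) (u : E N → ℝ) :
    Prop :=
  ∀ y ∈ Ω, ∀ (φ : E N → ℝ) (hφ : ContDiffAt ℝ 2 φ y),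
    IsLocalMax (fun w => u w - φ w) y → -ε ^ 2 * M (hessian φ y hφ) + u y ≤ 0

/-- `u` is a viscosity super-solution of `-ε² M(∇²u) + u = 0` in `Ω`. -/
def IsViscositySupersolution {N : ℕ} (M : SymMat N → ℝ) (ε : ℝ) (Ω : Set (E N)) (u : E N → ℝ) :
    Prop :=
  ∀ y ∈ Ω, ∀ (φ : E N → ℝ) (hφ : ContDiffAt ℝ 2 φ y),
    IsLocalMin (fun w => u w - φ w) y → 0 ≤ -ε ^ 2 * M (hessian φ y hφ) + u y

/-- `u` is a bounded viscosity solution, continuous up to the boundary, of the problem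
`-ε² M(∇²u) + u = 0` in `Ω`, `u = 1` on `∂Ω`. -/
structure IsSolution {N : ℕ} (M : SymMat N → ℝ) (ε : ℝ) (Ω : Set (E N)) (u : E N → ℝ) :
    Prop where
  continuousOn : ContinuousOn u (closure Ω)
  bounded : ∃ C : ℝ, ∀ y ∈ closure Ω, |u y| ≤ C
  boundary : ∀ y ∈ frontier Ω, u y = 1
  subsolution : IsViscositySubsolution M ε Ω u
  supersolution : IsViscositySupersolution M ε Ω u

/-- Near `z`, in the Cartesian coordinates `(y', y_N) = T y`, the set `Ω` is the part of `ℝᴺ`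
above the graph of the `C²` function `ζ`, and its boundary is the graph of `ζ`. -/
def IsLocalC2Graph {N : ℕ} (Ω : Set (E N)) (z : E N)
    (T : E N ≃ᵃⁱ[ℝ] WithLp 2 (E (N - 1) × ℝ)) (ζ : E (N - 1) → ℝ) : Prop :=
  ContDiff ℝ 2 ζ ∧ ∃ r > 0, ∀ y ∈ Metric.ball z r,
    (y ∈ Ω ↔ ζ (T y).fst < (T y).snd) ∧ (y ∈ frontier Ω ↔ ζ (T y).fst = (T y).snd)

/-- `Ω` is an open set of class `C²`: near each of its boundary points it is, in suitable
Cartesian coordinates, one side of the graph of a `C²` function. -/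
def IsC2Domain {N : ℕ} (Ω : Set (E N)) : Prop :=
  IsOpen Ω ∧ ∀ z ∈ frontier Ω, ∃ T ζ, IsLocalC2Graph Ω z T ζ

/-- `κ` lists, with multiplicity, the principal curvatures of `∂Ω` at `z` with respect to the
inner normal (those of a ball of radius `r` are `1 / r`): in a principal coordinate system at `z`,
with last axis along the inner normal, `∂Ω` is near `z` the graph of a `C²` function whose
gradient vanishes and whose Hessian is the diagonal matrix of `κ` at the point under `z`. -/
def IsPrincipalCurvatures {N : ℕ} (Ω : Set (E N)) (z : E N) (κ : Fin (N - 1) → ℝ) : Prop :=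
  ∃ T ζ, IsLocalC2Graph Ω z T ζ ∧ fderiv ℝ ζ (T z).fst = 0 ∧
    hessianMatrix ζ (T z).fst = Matrix.diagonal κ

/-- `m` is the unique minimum point of `c ↦ ‖u - c‖` in `L^q(B)`. -/
def IsQMean {N : ℕ} (q : ℝ≥0∞) (u : E N → ℝ) (B : Set (E N)) (m : ℝ) : Prop :=
  ∀ c : ℝ, c ≠ m → eLpNorm (fun y => u y - m) q (volume.restrict B) <
    eLpNorm (fun y => u y - c) q (volume.restrict B)

/-- The `q`-mean of `u` on `B`: the unique minimum point of `c ↦ ‖u - c‖` in `L^q(B)`. -/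
def qMean {N : ℕ} (q : ℝ≥0∞) (u : E N → ℝ) (B : Set (E N)) : ℝ :=
  Classical.epsilon (IsQMean q u B)

/-- The product `Π₀ = ∏ⱼ (1 - R κⱼ)`. -/
def Pi0 {n : ℕ} (R : ℝ) (κ : Fin n → ℝ) : ℝ := ∏ j, (1 - R * κ j)

/-- The constant `c_{N,q}`. -/
def cNq (N : ℕ) (q : ℝ) : ℝ :=
  ((2 : ℝ) ^ (-(((N : ℝ) + 1) / 2)) * (N.factorial : ℝ) /
    ((q - 1) ^ (((N : ℝ) + 1) / 2) * Real.Gamma (((N : ℝ) + 1) / 2))) ^ (1 / (q - 1))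

end PucciMeans

end

open PucciMeans

/-!
The proof uses explicit barriers at the touching point `z` only, and no general theory of viscosity
solutions.

*Local profile.* On a matrix that is nearly `s g ⊗ g` with `s ≥ 0`, both Pucci operators are nearly
`θ s |g|²`, where `θ = λ` for the minimal and `θ = Λ` for the maximal operator (`IsRankOneStable`).
The Hessian of `exp (-F / (√θ ε))` is of this form to leading order in `ε`, with `g = ∇F`. Taking for
`F` the quadratic polynomial that osculates the distance to the boundary at `z`, tilted slightly to
one side or the other, and for the rate a number slightly smaller or larger than `1 / (√θ ε)`, one
gets strict super- and sub-solutions near `z`. A further term `± exp (b (|y - z|² - r²))`, with `b` a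
small multiple of `1 / ε`, makes the comparison local; `0 ≤ u ≤ 1` is all that is used about `u` on
the sphere of radius `r`. Comparison with a smooth strict barrier is immediate from the definition of
viscosity solutions (`le_barrier`, `barrier_le`).

*Blow-up.* In the frame at `z`, write `y - z = (√ε v, ε t)` (`blowUp`). The bounds give
`u → exp (-(t - ½ ∑ κⱼ vⱼ²) / √θ)` pointwise, the ball `B_R(x)` becomes `|v|² < 2 R t`, and
`κⱼ < 1 / R` yields an integrable bound on the ball (`exists_exp_decay`). Hence
`ε^{-(N+1)/2} ∫_B u^{q-1}` converges to a Gaussian integral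
(`tendsto_integral_rpow`, `integral_profile`).

*Means.* By strict convexity the `q`-mean `m` is the zero of `∫_B sgn(m - u) |m - u|^{q-1}`. It is of
a power order in `ε`, whereas `u` is exponentially small away from `z`, so that this integral is
`m^{q-1} |B| - ∫_B u^{q-1}` up to lower order terms (`tendsto_zero_div_rpow`). This determines the
limit; the constant is put into closed form by the duplication formula of the gamma function. For
`q = ∞` the mean is the midpoint of the range of `u` on the ball, whose supremum is one and whose
infimum tends to zero.
-/

/-! ### Pucci operators on matrices that are almost of rank one -/

/-- The operator `M` is `θ` times the trace on positive semidefinite matrices of rank one, and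
this is stable: whenever the quadratic form of `X` is within `k |h|²` of `s ⟨g, h⟩²`, `s ≥ 0`, the
number `M X` is within `C k` of `θ s |g|²`. This is all that the argument needs to know about the
Pucci operators. -/
def IsRankOneStable {N : ℕ} (θ C : ℝ) (M : SymMat N → ℝ) : Prop :=
  ∀ (X : SymMat N) (s : ℝ) (g : E N) (k : ℝ), 0 ≤ s →
    (∀ h : E N, |h.ofLp ⬝ᵥ X.1.mulVec h.ofLp - s * (inner ℝ g h) ^ 2| ≤ k * ‖h‖ ^ 2) →
    |M X - θ * (s * ‖g‖ ^ 2)| ≤ C * k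

theorem isRankOneStable_of_eigenvalues {N : ℕ} {a b K : ℝ} (ha : 0 ≤ a) (hb : 0 ≤ b)
    (haK : a ≤ K) (hbK : b ≤ K) {M : SymMat N → ℝ}
    (hM : ∀ X, M X = a * (∑ i with X.2.eigenvalues i < 0, X.2.eigenvalues i) +
      b * (∑ i with 0 < X.2.eigenvalues i, X.2.eigenvalues i)) :
    IsRankOneStable b (N * K) M := by
  intro X s g k hs h
  have key : ∀ i, |X.2.eigenvalues i - s * (inner ℝ g (X.2.eigenvectorBasis i)) ^ 2| ≤ k := by
    intro i
    have h1 := h (X.2.eigenvectorBasis i)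
    have h2 : (X.2.eigenvectorBasis i).ofLp ⬝ᵥ (X.2.eigenvectorBasis i).ofLp = 1 := by
      have := EuclideanSpace.inner_eq_star_dotProduct (X.2.eigenvectorBasis i)
        (X.2.eigenvectorBasis i)
      simp only [star_trivial] at this
      rw [← this]
      simp
    rw [X.2.mulVec_eigenvectorBasis, dotProduct_smul, h2] at h1
    simpa using h1
  have hsum : M X = ∑ i, (if X.2.eigenvalues i < 0 then a * X.2.eigenvalues i
      else b * X.2.eigenvalues i) := by
    rw [hM, Finset.mul_sum, Finset.mul_sum, Finset.sum_filter, Finset.sum_filter,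
      ← Finset.sum_add_distrib]
    refine Finset.sum_congr rfl fun i _ => ?_
    rcases lt_trichotomy (X.2.eigenvalues i) 0 with h0 | h0 | h0
    · simp [h0, not_lt.2 h0.le]
    · simp [h0]
    · simp [h0, not_lt.2 h0.le]
  have hg : ‖g‖ ^ 2 = ∑ i, (inner ℝ g (X.2.eigenvectorBasis i)) ^ 2 := by
    rw [← X.2.eigenvectorBasis.sum_sq_inner_left g]
  rw [hsum, hg, Finset.mul_sum, Finset.mul_sum, ← Finset.sum_sub_distrib]
  refine (Finset.abs_sum_le_sum_abs _ _).trans ?_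
  have hi : ∀ i ∈ Finset.univ, |(if X.2.eigenvalues i < 0 then a * X.2.eigenvalues i
      else b * X.2.eigenvalues i) - b * (s * (inner ℝ g (X.2.eigenvectorBasis i)) ^ 2)| ≤
      K * k := by
    intro i _
    have hk := key i
    set r := s * (inner ℝ g (X.2.eigenvectorBasis i)) ^ 2
    have hr : 0 ≤ r := mul_nonneg hs (sq_nonneg _)
    set t := X.2.eigenvalues i
    have hK : 0 ≤ K := ha.trans haK
    refine le_trans ?_ (mul_le_mul_of_nonneg_left hk hK)
    split_ifs with ht
    · rw [abs_of_neg (by linarith : t - r < 0), abs_of_nonpos (by nlinarith)]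
      nlinarith
    · rw [← mul_sub, abs_mul, abs_of_nonneg hb]
      exact mul_le_mul_of_nonneg_right hbK (abs_nonneg _)
  refine (Finset.sum_le_sum hi).trans ?_
  simp [mul_assoc]

theorem pucciMinus_isRankOneStable {N : ℕ} {lam Lam : ℝ} (hlam : 0 < lam) (hLam : lam ≤ Lam) :
    IsRankOneStable lam (N * Lam) (pucciMinus (N := N) lam Lam) :=
  isRankOneStable_of_eigenvalues (by linarith) hlam.le le_rfl hLam fun _ => rfl

theorem pucciPlus_isRankOneStable {N : ℕ} {lam Lam : ℝ} (hlam : 0 < lam) (hLam : lam ≤ Lam) :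
    IsRankOneStable Lam (N * Lam) (pucciPlus (N := N) lam Lam) :=
  isRankOneStable_of_eigenvalues hlam.le (by linarith) hLam le_rfl fun _ => rfl

/-! ### Hessians along lines -/

theorem hessianMatrix_dotProduct {N : ℕ} (φ : E N → ℝ) (y h : E N) :
    h.ofLp ⬝ᵥ (hessianMatrix φ y).mulVec h.ofLp = fderiv ℝ (fderiv ℝ φ) y h h := by
  have hh : h = ∑ i, h i • EuclideanSpace.single i (1 : ℝ) := by
    have := (EuclideanSpace.basisFun (Fin N) ℝ).sum_repr h
    simpa using this.symm
  conv_rhs => rw [hh]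
  simp only [map_sum, map_smul, sum_apply, smul_apply, Finset.mul_sum,
    smul_eq_mul, dotProduct, Matrix.mulVec, hessianMatrix, Matrix.of_apply]
  rw [Finset.sum_comm]
  refine Finset.sum_congr rfl fun i _ => Finset.sum_congr rfl fun j _ => ?_
  ring

/-- The second derivative in direction `h` is computed along the line through `y`. -/
theorem fderiv_fderiv_eq_of_line {N : ℕ} {φ : E N → ℝ} {y h : E N} (hφ : ContDiffAt ℝ 2 φ y)
    {f f' : ℝ → ℝ} {c : ℝ} (hf : ∀ s, φ (y + s • h) = f s) (hf' : ∀ s, HasDerivAt f (f' s) s)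
    (hc : HasDerivAt f' c 0) : fderiv ℝ (fderiv ℝ φ) y h h = c := by
  have hline : ∀ s : ℝ, HasDerivAt (fun s : ℝ => y + s • h) h s := fun s => by
    simpa using ((hasDerivAt_id s).smul_const h).const_add y
  have h1 : ∀ᶠ s in 𝓝 (0 : ℝ), fderiv ℝ φ (y + s • h) h = f' s := by
    have hd : ∀ᶠ w in 𝓝 y, DifferentiableAt ℝ φ w :=
      (hφ.eventually (by simp)).mono fun w hw => hw.differentiableAt (by simp)
    have ht : Tendsto (fun s : ℝ => y + s • h) (𝓝 0) (𝓝 y) := by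
      have := (hline 0).continuousAt.tendsto
      simpa using this
    filter_upwards [ht.eventually hd] with s hs
    have h2 := hs.hasFDerivAt.comp_hasDerivAt s (hline s)
    have h3 : φ ∘ (fun s : ℝ => y + s • h) = f := funext hf
    rw [h3] at h2
    exact h2.unique (hf' s)
  have hD : DifferentiableAt ℝ (fderiv ℝ φ) y :=
    (hφ.fderiv_right (m := 1) (by norm_num)).differentiableAt (by simp)
  have h0 : HasDerivAt (fun s : ℝ => fderiv ℝ φ (y + s • h)) (fderiv ℝ (fderiv ℝ φ) y h) 0 := by
    have hD' : HasFDerivAt (fderiv ℝ φ) (fderiv ℝ (fderiv ℝ φ) y) (y + (0 : ℝ) • h) := by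
      simpa using hD.hasFDerivAt
    exact hD'.comp_hasDerivAt 0 (hline 0)
  have h4 : HasDerivAt (fun s : ℝ => fderiv ℝ φ (y + s • h) h) (fderiv ℝ (fderiv ℝ φ) y h h) 0 :=
    h0.clm_apply (hasDerivAt_const _ _) |>.congr_deriv (by simp)
  exact h4.unique (hc.congr_of_eventuallyEq h1)

/-! ### Comparison with smooth strict barriers -/

/-- Comparison with a smooth strict super-solution needs nothing but the definition of a viscosity
sub-solution: the barrier is a test function at a maximum point of the difference. -/
theorem le_barrier {N : ℕ} {M : SymMat N → ℝ} {ε : ℝ} {Ω : Set (E N)} {u φ : E N → ℝ}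
    (hΩ : IsOpen Ω) (hu : IsSolution M ε Ω u) (hφ : ContDiff ℝ 2 φ) {c : E N} {r : ℝ}
    (hstrict : ∀ y ∈ Ω ∩ Metric.ball c r, 0 < -ε ^ 2 * M (hessian φ y hφ.contDiffAt) + φ y)
    (hfr : ∀ y ∈ frontier Ω ∩ Metric.closedBall c r, u y ≤ φ y)
    (hsp : ∀ y ∈ Ω ∩ Metric.sphere c r, u y ≤ φ y) :
    ∀ y ∈ closure Ω ∩ Metric.closedBall c r, u y ≤ φ y := by
  intro y hy
  have hK : IsCompact (closure Ω ∩ Metric.closedBall c r) :=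
    (isCompact_closedBall c r).inter_left isClosed_closure
  obtain ⟨m, hm, hmax⟩ := hK.exists_isMaxOn ⟨y, hy⟩
    (f := fun w => u w - φ w)
    ((hu.continuousOn.mono inter_subset_left).sub hφ.continuous.continuousOn)
  by_contra hlt
  have hpos : 0 < u m - φ m := by
    have : u y - φ y ≤ u m - φ m := hmax hy
    linarith [not_le.1 hlt]
  have hmΩ : m ∈ Ω := by
    by_contra hn
    have := hfr m ⟨⟨hm.1, by rwa [hΩ.interior_eq]⟩, hm.2⟩
    linarith
  have hmb : m ∈ Metric.ball c r := by
    by_contra hn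
    have := hsp m ⟨hmΩ, le_antisymm hm.2 (not_lt.1 hn)⟩
    linarith
  have hloc : IsLocalMax (fun w => u w - φ w) m := by
    filter_upwards [(hΩ.inter Metric.isOpen_ball).mem_nhds ⟨hmΩ, hmb⟩] with w hw
    exact hmax ⟨subset_closure hw.1, Metric.ball_subset_closedBall hw.2⟩
  have h1 := hu.subsolution m hmΩ φ hφ.contDiffAt hloc
  have h2 := hstrict m ⟨hmΩ, hmb⟩
  linarith

theorem barrier_le {N : ℕ} {M : SymMat N → ℝ} {ε : ℝ} {Ω : Set (E N)} {u φ : E N → ℝ}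
    (hΩ : IsOpen Ω) (hu : IsSolution M ε Ω u) (hφ : ContDiff ℝ 2 φ) {c : E N} {r : ℝ}
    (hstrict : ∀ y ∈ Ω ∩ Metric.ball c r, -ε ^ 2 * M (hessian φ y hφ.contDiffAt) + φ y < 0)
    (hfr : ∀ y ∈ frontier Ω ∩ Metric.closedBall c r, φ y ≤ u y)
    (hsp : ∀ y ∈ Ω ∩ Metric.sphere c r, φ y ≤ u y) :
    ∀ y ∈ closure Ω ∩ Metric.closedBall c r, φ y ≤ u y := by
  intro y hy
  have hK : IsCompact (closure Ω ∩ Metric.closedBall c r) :=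
    (isCompact_closedBall c r).inter_left isClosed_closure
  obtain ⟨m, hm, hmin⟩ := hK.exists_isMinOn ⟨y, hy⟩
    (f := fun w => u w - φ w)
    ((hu.continuousOn.mono inter_subset_left).sub hφ.continuous.continuousOn)
  by_contra hlt
  have hneg : u m - φ m < 0 := by
    have : u m - φ m ≤ u y - φ y := hmin hy
    linarith [not_le.1 hlt]
  have hmΩ : m ∈ Ω := by
    by_contra hn
    have := hfr m ⟨⟨hm.1, by rwa [hΩ.interior_eq]⟩, hm.2⟩
    linarith
  have hmb : m ∈ Metric.ball c r := by
    by_contra hn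
    have := hsp m ⟨hmΩ, le_antisymm hm.2 (not_lt.1 hn)⟩
    linarith
  have hloc : IsLocalMin (fun w => u w - φ w) m := by
    filter_upwards [(hΩ.inter Metric.isOpen_ball).mem_nhds ⟨hmΩ, hmb⟩] with w hw
    exact hmin ⟨subset_closure hw.1, Metric.ball_subset_closedBall hw.2⟩
  have h1 := hu.supersolution m hmΩ φ hφ.contDiffAt hloc
  have h2 := hstrict m ⟨hmΩ, hmb⟩
  linarith

/-! ### The bounds `0 ≤ u ≤ 1` -/

theorem norm_add_smul_sq {N : ℕ} (w h : E N) (s : ℝ) :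
    ‖w + s • h‖ ^ 2 = ‖w‖ ^ 2 + s * (2 * inner ℝ w h) + s ^ 2 * ‖h‖ ^ 2 := by
  rw [norm_add_sq_real, inner_smul_right, norm_smul, mul_pow, Real.norm_eq_abs, sq_abs]
  ring

theorem hasDerivAt_quadratic (p q r s : ℝ) :
    HasDerivAt (fun s : ℝ => p + s * q + s ^ 2 * r) (q + 2 * s * r) s := by
  have h1 := ((hasDerivAt_id s).mul_const q).const_add p
  have h2 := (hasDerivAt_pow 2 s).mul_const r
  refine (h1.add h2).congr_deriv ?_
  simp

theorem abs_pucci_quadratic_le {N : ℕ} {M : SymMat N → ℝ} {θ C : ℝ} (hM : IsRankOneStable θ C M)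
    {φ : E N → ℝ} (hφ : ContDiff ℝ 2 φ) {c₀ d : ℝ} (hd : ∀ y, φ y = c₀ + d * ‖y‖ ^ 2) (y : E N) :
    |M (hessian φ y hφ.contDiffAt)| ≤ C * (2 * |d|) := by
  have h := hM (hessian φ y hφ.contDiffAt) 0 0 (2 * |d|) le_rfl fun h => by
    have h1 : fderiv ℝ (fderiv ℝ φ) y h h = 2 * (d * ‖h‖ ^ 2) := by
      refine fderiv_fderiv_eq_of_line hφ.contDiffAt
        (f := fun s => (c₀ + d * ‖y‖ ^ 2) + s * (d * (2 * inner ℝ y h)) + s ^ 2 * (d * ‖h‖ ^ 2))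
        (fun s => ?_) (fun s => hasDerivAt_quadratic _ _ _ s) ?_
      · rw [hd, norm_add_smul_sq]
        ring
      · simpa using (((hasDerivAt_id (0 : ℝ)).const_mul 2).mul_const
          (d * ‖h‖ ^ 2)).const_add (d * (2 * inner ℝ y h))
    rw [show (hessian φ y hφ.contDiffAt).1 = hessianMatrix φ y from rfl,
      hessianMatrix_dotProduct, h1, zero_mul, sub_zero, abs_mul, abs_mul, abs_two,
      abs_of_nonneg (sq_nonneg ‖h‖)]
    linarith
  simpa using h

theorem contDiff_quadratic {N : ℕ} (c₀ d : ℝ) :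
    ContDiff ℝ 2 (fun y : E N => c₀ + d * ‖y‖ ^ 2) :=
  contDiff_const.add (contDiff_const.mul (contDiff_norm_sq ℝ))

section Bounds

variable {N : ℕ} {M : SymMat N → ℝ} {θ C ε : ℝ} {Ω : Set (E N)} {u : E N → ℝ}

/-- The perturbation `δ |y|²` makes up for the unboundedness of `Ω`: on a large sphere it exceeds
the bound of `u`. -/
theorem PucciMeans.IsSolution.le_one (hM : IsRankOneStable θ C M) (hC : 0 ≤ C) (hΩ : IsOpen Ω)
    (hu : IsSolution M ε Ω u) {y : E N} (hy : y ∈ closure Ω) : u y ≤ 1 := by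
  obtain ⟨A, hA⟩ := hu.bounded
  have key : ∀ δ > 0, u y ≤ 1 + δ * (2 * ε ^ 2 * C + 1) + δ * ‖y‖ ^ 2 := by
    intro δ hδ
    set c₀ := 1 + δ * (2 * ε ^ 2 * C + 1) with hc₀
    have hc₁ : 1 ≤ c₀ := by
      have : 0 ≤ δ * (2 * ε ^ 2 * C + 1) := by positivity
      linarith
    set r := max ‖y‖ (max 1 (A / δ)) with hr
    have hAr : A ≤ δ * r ^ 2 := by
      have h1 : A / δ ≤ r := (le_max_right _ _).trans (le_max_right _ _)
      have h2 : 1 ≤ r := (le_max_left _ _).trans (le_max_right _ _)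
      rw [div_le_iff₀ hδ] at h1
      nlinarith [mul_nonneg hδ.le (by nlinarith : 0 ≤ r ^ 2 - r)]
    refine le_barrier hΩ hu (contDiff_quadratic c₀ δ) (c := 0) (r := r) ?_ ?_ ?_ y
      ⟨hy, by simp [hr]⟩
    · intro w _
      have h1 := (abs_le.1 (abs_pucci_quadratic_le hM (contDiff_quadratic c₀ δ)
        (fun _ => rfl) w)).2
      rw [abs_of_pos hδ] at h1
      have h2 := mul_le_mul_of_nonneg_left h1 (sq_nonneg ε)
      have : 0 ≤ δ * ‖w‖ ^ 2 := by positivity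
      linarith
    · intro w hw
      rw [hu.boundary w hw.1]
      have : 0 ≤ δ * ‖w‖ ^ 2 := by positivity
      linarith
    · intro w hw
      have h1 : ‖w‖ = r := by simpa using hw.2
      have h2 := (abs_le.1 (hA w (subset_closure hw.1))).2
      rw [h1]
      linarith
  have hlim : Tendsto (fun δ : ℝ => 1 + δ * (2 * ε ^ 2 * C + 1) + δ * ‖y‖ ^ 2) (𝓝[>] 0)
      (𝓝 1) := by
    have h : Continuous (fun δ : ℝ => 1 + δ * (2 * ε ^ 2 * C + 1) + δ * ‖y‖ ^ 2) := by fun_prop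
    simpa using (h.tendsto 0).mono_left nhdsWithin_le_nhds
  exact ge_of_tendsto hlim (eventually_mem_nhdsWithin.mono key)

theorem PucciMeans.IsSolution.nonneg (hM : IsRankOneStable θ C M) (hC : 0 ≤ C) (hΩ : IsOpen Ω)
    (hu : IsSolution M ε Ω u) {y : E N} (hy : y ∈ closure Ω) : 0 ≤ u y := by
  obtain ⟨A, hA⟩ := hu.bounded
  have key : ∀ δ > 0, -(δ * (2 * ε ^ 2 * C + 1)) + (-δ) * ‖y‖ ^ 2 ≤ u y := by
    intro δ hδ
    set c₀ := -(δ * (2 * ε ^ 2 * C + 1)) with hc₀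
    have hc₁ : c₀ ≤ 0 := by
      have : 0 ≤ δ * (2 * ε ^ 2 * C + 1) := by positivity
      linarith
    set r := max ‖y‖ (max 1 (A / δ)) with hr
    have hAr : A ≤ δ * r ^ 2 := by
      have h1 : A / δ ≤ r := (le_max_right _ _).trans (le_max_right _ _)
      have h2 : 1 ≤ r := (le_max_left _ _).trans (le_max_right _ _)
      rw [div_le_iff₀ hδ] at h1
      nlinarith [mul_nonneg hδ.le (by nlinarith : 0 ≤ r ^ 2 - r)]
    refine barrier_le hΩ hu (contDiff_quadratic c₀ (-δ)) (c := 0) (r := r) ?_ ?_ ?_ y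
      ⟨hy, by simp [hr]⟩
    · intro w _
      have h1 := (abs_le.1 (abs_pucci_quadratic_le hM (contDiff_quadratic c₀ (-δ))
        (fun _ => rfl) w)).1
      rw [abs_neg, abs_of_pos hδ] at h1
      have h2 := mul_le_mul_of_nonneg_left h1 (sq_nonneg ε)
      have : 0 ≤ δ * ‖w‖ ^ 2 := by positivity
      linarith
    · intro w hw
      rw [hu.boundary w hw.1]
      have : 0 ≤ δ * ‖w‖ ^ 2 := by positivity
      linarith
    · intro w hw
      have h1 : ‖w‖ = r := by simpa using hw.2
      have h2 := (abs_le.1 (hA w (subset_closure hw.1))).1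
      rw [h1]
      linarith
  have hlim : Tendsto (fun δ : ℝ => -(δ * (2 * ε ^ 2 * C + 1)) + (-δ) * ‖y‖ ^ 2) (𝓝[>] 0)
      (𝓝 0) := by
    have h : Continuous (fun δ : ℝ => -(δ * (2 * ε ^ 2 * C + 1)) + (-δ) * ‖y‖ ^ 2) := by
      fun_prop
    simpa using (h.tendsto 0).mono_left nhdsWithin_le_nhds
  exact le_of_tendsto hlim (eventually_mem_nhdsWithin.mono key)

end Bounds

/-! ### Exponential barriers over paraboloids -/

/-- The quadratic polynomial `⟨ν, w⟩ - ½ ∑ⱼ κⱼ ⟨eⱼ, w⟩² - η |w|²`, `w = y - z`. With `ν` the inner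
normal and `κ` the principal curvatures of a surface at `z`, it agrees for `η = 0` with the
distance to the surface up to second order, and `η` tilts its zero set to either side. -/
noncomputable def paraboloid {N n : ℕ} (ν : E N) (e : Fin n → E N) (κ : Fin n → ℝ) (η : ℝ) (z y : E N) : ℝ :=
  inner ℝ ν (y - z) - (∑ j, κ j * (inner ℝ (e j) (y - z)) ^ 2) / 2 - η * ‖y - z‖ ^ 2

/-- The gradient of `paraboloid`. -/
noncomputable def paraboloidGrad {N n : ℕ} (ν : E N) (e : Fin n → E N) (κ : Fin n → ℝ) (η : ℝ) (z y : E N) :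
    E N :=
  ν - (∑ j, (κ j * inner ℝ (e j) (y - z)) • e j) - (2 * η) • (y - z)

/-- A bound for the second order part of `paraboloid`. -/
noncomputable def curvBound {n : ℕ} (κ : Fin n → ℝ) (η : ℝ) : ℝ := (∑ j, |κ j|) / 2 + |η|

section Paraboloid

variable {N n : ℕ} (ν : E N) (e : Fin n → E N) (κ : Fin n → ℝ) (η : ℝ) (z : E N)

theorem curvBound_nonneg : 0 ≤ curvBound κ η := by
  unfold curvBound; positivity

theorem paraboloid_contDiff : ContDiff ℝ 2 (paraboloid ν e κ η z) := by
  unfold paraboloid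
  have h : ContDiff ℝ 2 (fun y : E N => y - z) := contDiff_id.sub contDiff_const
  refine ((contDiff_const.inner ℝ h).sub (ContDiff.div_const (ContDiff.sum fun j _ =>
    contDiff_const.mul ((contDiff_const.inner ℝ h).pow 2)) _)).sub (contDiff_const.mul
      (h.norm_sq ℝ))

theorem paraboloid_line (y h : E N) (s : ℝ) :
    paraboloid ν e κ η z (y + s • h) = paraboloid ν e κ η z y +
      s * inner ℝ (paraboloidGrad ν e κ η z y) h +
      s ^ 2 * (-((∑ j, κ j * (inner ℝ (e j) h) ^ 2) / 2 + η * ‖h‖ ^ 2)) := by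
  unfold paraboloid paraboloidGrad
  have h1 : y + s • h - z = (y - z) + s • h := by abel
  have h2 : ∀ j, κ j * (inner ℝ (e j) (y - z + s • h)) ^ 2 =
      κ j * (inner ℝ (e j) (y - z)) ^ 2 + s * (2 * (κ j * inner ℝ (e j) (y - z) *
        inner ℝ (e j) h)) + s ^ 2 * (κ j * (inner ℝ (e j) h) ^ 2) := by
    intro j
    rw [inner_add_right, inner_smul_right]
    ring
  rw [h1, norm_add_smul_sq, Finset.sum_congr rfl fun j _ => h2 j, Finset.sum_add_distrib,
    Finset.sum_add_distrib, ← Finset.mul_sum, ← Finset.mul_sum, ← Finset.mul_sum]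
  simp only [inner_sub_left, sum_inner, real_inner_smul_left, inner_add_right, inner_smul_right]
  ring

variable {e} (he : ∀ j, ‖e j‖ = 1)
include he

theorem abs_sum_curv_le (h : E N) :
    |(∑ j, κ j * (inner ℝ (e j) h) ^ 2) / 2 + η * ‖h‖ ^ 2| ≤ curvBound κ η * ‖h‖ ^ 2 := by
  have h1 : |∑ j, κ j * (inner ℝ (e j) h) ^ 2| ≤ (∑ j, |κ j|) * ‖h‖ ^ 2 := by
    refine (Finset.abs_sum_le_sum_abs _ _).trans ?_
    rw [Finset.sum_mul]
    refine Finset.sum_le_sum fun j _ => ?_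
    rw [abs_mul, abs_of_nonneg (sq_nonneg (inner ℝ (e j) h))]
    refine mul_le_mul_of_nonneg_left ?_ (abs_nonneg _)
    have := abs_real_inner_le_norm (e j) h
    rw [he, one_mul] at this
    exact sq_le_sq.2 (by rwa [abs_norm])
  unfold curvBound
  refine (abs_add_le _ _).trans ?_
  rw [abs_div, abs_two, abs_mul, abs_of_nonneg (sq_nonneg ‖h‖)]
  linarith

theorem norm_paraboloidGrad_sub_le (y : E N) :
    ‖paraboloidGrad ν e κ η z y - ν‖ ≤ 2 * curvBound κ η * ‖y - z‖ := by
  have h1 : ‖∑ j, (κ j * inner ℝ (e j) (y - z)) • e j‖ ≤ (∑ j, |κ j|) * ‖y - z‖ := by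
    refine (norm_sum_le _ _).trans ?_
    rw [Finset.sum_mul]
    refine Finset.sum_le_sum fun j _ => ?_
    rw [norm_smul, he, mul_one, Real.norm_eq_abs, abs_mul]
    refine mul_le_mul_of_nonneg_left ?_ (abs_nonneg _)
    have := abs_real_inner_le_norm (e j) (y - z)
    rwa [he, one_mul] at this
  have h2 : paraboloidGrad ν e κ η z y - ν =
      -(∑ j, (κ j * inner ℝ (e j) (y - z)) • e j) - (2 * η) • (y - z) := by
    unfold paraboloidGrad
    abel
  rw [h2]
  refine (norm_sub_le _ _).trans ?_
  rw [norm_neg, norm_smul, Real.norm_eq_abs, abs_mul, abs_two]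
  unfold curvBound
  linarith

end Paraboloid

/-- `α e^{-aF} + σ e^{b(|y - z|² - r²)}` with `F` a `paraboloid`. The first term is the local profile
of a solution; the second one, of size one on the sphere of radius `r` around `z` and exponentially
small near `z`, localizes the comparison. -/
noncomputable def expBarrier {N n : ℕ} (ν : E N) (e : Fin n → E N) (κ : Fin n → ℝ) (η : ℝ) (z : E N)
    (α σ a b r : ℝ) (y : E N) : ℝ :=
  α * Real.exp (-a * paraboloid ν e κ η z y) + σ * Real.exp (b * (‖y - z‖ ^ 2 - r ^ 2))

section Barrier

variable {N n : ℕ} (ν : E N) (e : Fin n → E N) (κ : Fin n → ℝ) (η : ℝ) (z : E N) (α σ a b r : ℝ)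

theorem expBarrier_contDiff : ContDiff ℝ 2 (expBarrier ν e κ η z α σ a b r) := by
  unfold expBarrier
  have h : ContDiff ℝ 2 (fun y : E N => y - z) := contDiff_id.sub contDiff_const
  exact (contDiff_const.mul (contDiff_const.mul (paraboloid_contDiff ν e κ η z)).exp).add
    (contDiff_const.mul (contDiff_const.mul ((h.norm_sq ℝ).sub contDiff_const)).exp)

theorem hasDerivAt_exp_quadratic (p q r s : ℝ) :
    HasDerivAt (fun s : ℝ => Real.exp (p + s * q + s ^ 2 * r))
      ((q + 2 * s * r) * Real.exp (p + s * q + s ^ 2 * r)) s := by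
  refine (hasDerivAt_quadratic p q r s).exp.congr_deriv ?_
  ring

theorem hasDerivAt_deriv_exp_quadratic (p q r : ℝ) :
    HasDerivAt (fun s : ℝ => (q + 2 * s * r) * Real.exp (p + s * q + s ^ 2 * r))
      ((q ^ 2 + 2 * r) * Real.exp p) 0 := by
  have h1 : HasDerivAt (fun s : ℝ => q + 2 * s * r) (2 * r) 0 := by
    simpa using (((hasDerivAt_id (0 : ℝ)).const_mul 2).mul_const r).const_add q
  refine (h1.mul (hasDerivAt_exp_quadratic p q r 0)).congr_deriv ?_
  simp
  ring

theorem expBarrier_fderiv_fderiv (y h : E N) :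
    fderiv ℝ (fderiv ℝ (expBarrier ν e κ η z α σ a b r)) y h h =
      α * (((a * inner ℝ (paraboloidGrad ν e κ η z y) h) ^ 2 +
        2 * a * ((∑ j, κ j * (inner ℝ (e j) h) ^ 2) / 2 + η * ‖h‖ ^ 2)) *
          Real.exp (-a * paraboloid ν e κ η z y)) +
      σ * (((2 * b * inner ℝ (y - z) h) ^ 2 + 2 * b * ‖h‖ ^ 2) *
        Real.exp (b * (‖y - z‖ ^ 2 - r ^ 2))) := by
  set q := inner ℝ (paraboloidGrad ν e κ η z y) h with hq
  set k := (∑ j, κ j * (inner ℝ (e j) h) ^ 2) / 2 + η * ‖h‖ ^ 2 with hk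
  refine fderiv_fderiv_eq_of_line (expBarrier_contDiff ν e κ η z α σ a b r).contDiffAt
    (f := fun s => α * Real.exp (-a * paraboloid ν e κ η z y + s * (-a * q) + s ^ 2 * (a * k)) +
      σ * Real.exp (b * (‖y - z‖ ^ 2 - r ^ 2) + s * (2 * b * inner ℝ (y - z) h) +
        s ^ 2 * (b * ‖h‖ ^ 2))) (fun s => ?_)
    (fun s => ((hasDerivAt_exp_quadratic _ _ _ s).const_mul α).add
      ((hasDerivAt_exp_quadratic _ _ _ s).const_mul σ)) ?_
  · unfold expBarrier
    rw [paraboloid_line, show y + s • h - z = (y - z) + s • h by abel, norm_add_smul_sq]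
    congr 3 <;> ring
  · refine (((hasDerivAt_deriv_exp_quadratic _ _ _).const_mul α).add
      ((hasDerivAt_deriv_exp_quadratic _ _ _).const_mul σ)).congr_deriv ?_
    ring

variable {M : SymMat N → ℝ} {θ C : ℝ}

/-- On an exponential barrier the operator acts as `θ` times the square of the gradient of the
exponent of the first term, up to an error of lower order. -/
theorem abs_pucci_expBarrier_le (hM : IsRankOneStable θ C M) {e : Fin n → E N}
    (he : ∀ j, ‖e j‖ = 1) {α σ a b : ℝ} (hα : 0 ≤ α) (hσ : |σ| = 1) (ha : 0 ≤ a) (hb : 0 ≤ b)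
    {y : E N} (hy : ‖y - z‖ ≤ r) :
    |M (hessian _ y (expBarrier_contDiff ν e κ η z α σ a b r).contDiffAt) -
        θ * (α * Real.exp (-a * paraboloid ν e κ η z y) * a ^ 2 *
          ‖paraboloidGrad ν e κ η z y‖ ^ 2)| ≤
      C * (α * Real.exp (-a * paraboloid ν e κ η z y) * (2 * a * curvBound κ η) +
        Real.exp (b * (‖y - z‖ ^ 2 - r ^ 2)) * (4 * b ^ 2 * r ^ 2 + 2 * b)) := by
  set P := Real.exp (-a * paraboloid ν e κ η z y)
  set Q := Real.exp (b * (‖y - z‖ ^ 2 - r ^ 2)) with hQ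
  have hP0 : 0 ≤ α * P := mul_nonneg hα (Real.exp_pos _).le
  refine hM _ (α * P * a ^ 2) (paraboloidGrad ν e κ η z y) _ (by positivity) fun h => ?_
  rw [show (hessian _ y (expBarrier_contDiff ν e κ η z α σ a b r).contDiffAt).1 =
    hessianMatrix (expBarrier ν e κ η z α σ a b r) y from rfl, hessianMatrix_dotProduct,
    expBarrier_fderiv_fderiv]
  set q := inner ℝ (paraboloidGrad ν e κ η z y) h
  have hk := abs_sum_curv_le κ η he h
  set k := (∑ j, κ j * (inner ℝ (e j) h) ^ 2) / 2 + η * ‖h‖ ^ 2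
  have h1 : (inner ℝ (y - z) h) ^ 2 ≤ r ^ 2 * ‖h‖ ^ 2 := by
    have h2 := abs_real_inner_le_norm (y - z) h
    have h3 : |inner ℝ (y - z) h| ≤ r * ‖h‖ :=
      h2.trans (mul_le_mul_of_nonneg_right hy (norm_nonneg _))
    rw [← mul_pow, ← sq_abs]
    exact pow_le_pow_left₀ (abs_nonneg _) h3 2
  have h4 : α * (((a * q) ^ 2 + 2 * a * k) * P) +
      σ * (((2 * b * inner ℝ (y - z) h) ^ 2 + 2 * b * ‖h‖ ^ 2) * Q) - α * P * a ^ 2 * q ^ 2 =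
      α * P * (2 * a) * k +
      σ * (((2 * b * inner ℝ (y - z) h) ^ 2 + 2 * b * ‖h‖ ^ 2) * Q) := by ring
  rw [h4]
  refine (abs_add_le _ _).trans ?_
  rw [abs_mul, abs_mul σ, hσ, one_mul, abs_of_nonneg (by positivity : 0 ≤ α * P * (2 * a)),
    abs_of_nonneg (by positivity : 0 ≤ ((2 * b * inner ℝ (y - z) h) ^ 2 + 2 * b * ‖h‖ ^ 2) * Q)]
  have h5 := mul_le_mul_of_nonneg_left hk (by positivity : 0 ≤ α * P * (2 * a))
  have h6 : ((2 * b * inner ℝ (y - z) h) ^ 2 + 2 * b * ‖h‖ ^ 2) * Q ≤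
      (4 * b ^ 2 * (r ^ 2 * ‖h‖ ^ 2) + 2 * b * ‖h‖ ^ 2) * Q := by
    refine mul_le_mul_of_nonneg_right ?_ (Real.exp_pos _).le
    nlinarith [mul_le_mul_of_nonneg_left h1 (by positivity : 0 ≤ 4 * b ^ 2)]
  linarith

variable {ε : ℝ} {Ω : Set (E N)} {u : E N → ℝ} {ν z r}

/-- The upper barrier. In the conditions on the parameters, `1 + 2 K r` with `K = curvBound κ η`
bounds the gradient of the paraboloid on the ball, and the remaining terms are of lower order if `a`
and `b` are of the order of `1 / ε`. -/
theorem PucciMeans.IsSolution.le_expBarrier (hM : IsRankOneStable θ C M) (hθ : 0 ≤ θ) (hC : 0 ≤ C)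
    (hΩ : IsOpen Ω) (hu : IsSolution M ε Ω u) (hν : ‖ν‖ = 1) {e : Fin n → E N}
    (he : ∀ j, ‖e j‖ = 1) {α a b : ℝ} (hα : 0 ≤ α) (ha : 0 ≤ a) (hb : 0 ≤ b)
    (h1 : ε ^ 2 * (θ * a ^ 2 * (1 + 2 * curvBound κ η * r) ^ 2 + C * (2 * a * curvBound κ η)) ≤ 1)
    (h2 : ε ^ 2 * (C * (4 * b ^ 2 * r ^ 2 + 2 * b)) < 1)
    (hfr : ∀ y ∈ frontier Ω ∩ Metric.closedBall z r, 1 ≤ expBarrier ν e κ η z α 1 a b r y) :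
    ∀ y ∈ closure Ω ∩ Metric.closedBall z r, u y ≤ expBarrier ν e κ η z α 1 a b r y := by
  refine le_barrier hΩ hu (expBarrier_contDiff ν e κ η z α 1 a b r) ?_ ?_ ?_
  · intro y hy
    have hyr : ‖y - z‖ ≤ r := by
      have := hy.2
      rw [Metric.mem_ball, dist_eq_norm] at this
      exact this.le
    have h3 := (abs_le.1 (abs_pucci_expBarrier_le (σ := 1) ν κ η z r hM he hα (by simp) ha hb
      hyr)).2
    have hK := curvBound_nonneg κ η
    have hG : ‖paraboloidGrad ν e κ η z y‖ ≤ 1 + 2 * curvBound κ η * r := by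
      have h4 := norm_paraboloidGrad_sub_le ν κ η z he y
      have h5 := norm_le_norm_add_norm_sub' (paraboloidGrad ν e κ η z y) ν
      have h6 := mul_le_mul_of_nonneg_left hyr (by positivity : 0 ≤ 2 * curvBound κ η)
      linarith
    have hG2 := pow_le_pow_left₀ (norm_nonneg _) hG 2
    show 0 < _ + expBarrier ν e κ η z α 1 a b r y
    rw [expBarrier]
    set P := Real.exp (-a * paraboloid ν e κ η z y)
    set Q := Real.exp (b * (‖y - z‖ ^ 2 - r ^ 2))
    have hP0 : 0 ≤ α * P := mul_nonneg hα (Real.exp_pos _).le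
    have hQ0 : 0 < Q := Real.exp_pos _
    have h7 : θ * (α * P * a ^ 2 * ‖paraboloidGrad ν e κ η z y‖ ^ 2) ≤
        α * P * (θ * a ^ 2 * (1 + 2 * curvBound κ η * r) ^ 2) := by
      have := mul_le_mul_of_nonneg_left hG2 (by positivity : 0 ≤ θ * (α * P * a ^ 2))
      linarith
    have h8 := mul_le_mul_of_nonneg_left (h3.trans' (sub_le_sub_left h7 _)) (sq_nonneg ε)
    have h9 := mul_le_mul_of_nonneg_left h1 hP0
    have h10 := mul_lt_mul_of_pos_left h2 hQ0
    linarith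
  · intro y hy
    rw [hu.boundary y hy.1]
    exact hfr y hy
  · intro y hy
    have h3 := hu.le_one hM hC hΩ (subset_closure hy.1)
    have h4 : ‖y - z‖ = r := by simpa [dist_eq_norm] using hy.2
    have : 0 ≤ α * Real.exp (-a * paraboloid ν e κ η z y) := mul_nonneg hα (Real.exp_pos _).le
    simp only [expBarrier, h4, sub_self, mul_zero, Real.exp_zero]
    linarith

/-- The lower barrier: on the sphere of radius `r` it is at most zero. -/
theorem PucciMeans.IsSolution.expBarrier_le (hM : IsRankOneStable θ C M) (hθ : 0 ≤ θ) (hC : 0 ≤ C)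
    (hΩ : IsOpen Ω) (hu : IsSolution M ε Ω u) (hν : ‖ν‖ = 1) {e : Fin n → E N}
    (he : ∀ j, ‖e j‖ = 1) {a b : ℝ} (ha : 0 ≤ a) (hb : 0 ≤ b)
    (hr : 2 * curvBound κ η * r ≤ 1)
    (h1 : 1 ≤ ε ^ 2 * (θ * a ^ 2 * (1 - 2 * curvBound κ η * r) ^ 2 - C * (2 * a * curvBound κ η)))
    (h2 : ε ^ 2 * (C * (4 * b ^ 2 * r ^ 2 + 2 * b)) < 1)
    (hF : ∀ y ∈ closure Ω ∩ Metric.closedBall z r, 0 ≤ paraboloid ν e κ η z y) :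
    ∀ y ∈ closure Ω ∩ Metric.closedBall z r, expBarrier ν e κ η z 1 (-1) a b r y ≤ u y := by
  have hle : ∀ y ∈ closure Ω ∩ Metric.closedBall z r,
      Real.exp (-a * paraboloid ν e κ η z y) ≤ 1 := fun y hy =>
    Real.exp_le_one_iff.2 (by have := mul_nonneg ha (hF y hy); linarith)
  refine barrier_le hΩ hu (expBarrier_contDiff ν e κ η z 1 (-1) a b r) ?_ ?_ ?_
  · intro y hy
    have hyr : ‖y - z‖ ≤ r := by
      have := hy.2
      rw [Metric.mem_ball, dist_eq_norm] at this
      exact this.le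
    have h3 := (abs_le.1 (abs_pucci_expBarrier_le (α := 1) (σ := -1) ν κ η z r hM he zero_le_one
      (by simp) ha hb hyr)).1
    have hK := curvBound_nonneg κ η
    have hG : 1 - 2 * curvBound κ η * r ≤ ‖paraboloidGrad ν e κ η z y‖ := by
      have h4 := norm_paraboloidGrad_sub_le ν κ η z he y
      have h5 := norm_le_norm_add_norm_sub (paraboloidGrad ν e κ η z y) ν
      have h6 := mul_le_mul_of_nonneg_left hyr (by positivity : 0 ≤ 2 * curvBound κ η)
      linarith
    have hG2 := pow_le_pow_left₀ (by linarith) hG 2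
    show _ + expBarrier ν e κ η z 1 (-1) a b r y < 0
    rw [expBarrier]
    set P := Real.exp (-a * paraboloid ν e κ η z y)
    set Q := Real.exp (b * (‖y - z‖ ^ 2 - r ^ 2))
    have hP0 : 0 ≤ P := (Real.exp_pos _).le
    have hQ0 : 0 < Q := Real.exp_pos _
    have h7 : P * (θ * a ^ 2 * (1 - 2 * curvBound κ η * r) ^ 2) ≤
        θ * (1 * P * a ^ 2 * ‖paraboloidGrad ν e κ η z y‖ ^ 2) := by
      have := mul_le_mul_of_nonneg_left hG2 (by positivity : 0 ≤ θ * (P * a ^ 2))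
      linarith
    have h8 := mul_le_mul_of_nonneg_left (h3.trans (sub_le_sub_left h7 _)) (sq_nonneg ε)
    have h9 := mul_le_mul_of_nonneg_left h1 hP0
    have h10 := mul_lt_mul_of_pos_left h2 hQ0
    linarith
  · intro y hy
    have h3 := hle y ⟨frontier_subset_closure hy.1, hy.2⟩
    rw [hu.boundary y hy.1, expBarrier]
    have := Real.exp_pos (b * (‖y - z‖ ^ 2 - r ^ 2))
    linarith
  · intro y hy
    have h3 := hu.nonneg hM hC hΩ (subset_closure hy.1)
    have h4 : ‖y - z‖ = r := by simpa [dist_eq_norm] using hy.2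
    have h5 := hle y ⟨subset_closure hy.1, Metric.sphere_subset_closedBall hy.2⟩
    simp only [expBarrier, h4, sub_self, mul_zero, Real.exp_zero]
    linarith

end Barrier

/-! ### Behaviour of the solutions near the touching point -/

section Frame

variable {N n : ℕ} (L : E N ≃ₗᵢ[ℝ] WithLp 2 (E n × ℝ))

/-- The unit vector that `L` maps to the last coordinate axis. -/
noncomputable def frameNormal : E N := L.symm (WithLp.toLp 2 (0, 1))

/-- The unit vector that `L` maps to the `j`-th coordinate axis. -/
noncomputable def frameTangent (j : Fin n) : E N :=
  L.symm (WithLp.toLp 2 (EuclideanSpace.single j 1, 0))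

theorem inner_symm_left (p : WithLp 2 (E n × ℝ)) (w : E N) :
    inner ℝ (L.symm p) w = inner ℝ p.fst (L w).fst + p.snd * (L w).snd := by
  rw [← L.inner_map_map, L.apply_symm_apply, WithLp.prod_inner_apply]
  simp [mul_comm]

theorem inner_frameNormal (w : E N) : inner ℝ (frameNormal L) w = (L w).snd := by
  simp [frameNormal, inner_symm_left]

theorem inner_frameTangent (j : Fin n) (w : E N) :
    inner ℝ (frameTangent L j) w = (L w).fst j := by
  simp [frameTangent, inner_symm_left, EuclideanSpace.inner_single_left]

theorem norm_frameNormal : ‖frameNormal L‖ = 1 := by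
  simp [frameNormal]

theorem norm_frameTangent (j : Fin n) : ‖frameTangent L j‖ = 1 := by
  simp [frameTangent]

theorem norm_sq_eq_frame (w : E N) : ‖w‖ ^ 2 = ‖(L w).fst‖ ^ 2 + (L w).snd ^ 2 := by
  rw [← L.norm_map, WithLp.prod_norm_sq_eq_of_L2]
  simp

theorem paraboloid_frame (κ : Fin n → ℝ) (η : ℝ) (z w : E N) :
    paraboloid (frameNormal L) (frameTangent L) κ η z (z + w) =
      (L w).snd - (∑ j, κ j * ((L w).fst j) ^ 2) / 2 - η * ‖w‖ ^ 2 := by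
  simp only [paraboloid, inner_frameNormal, inner_frameTangent, add_sub_cancel_left]

end Frame

/-- The closed ball of centre `x` and radius `R` meets the complement of the open set `Ω` only at `z`,
and in the frame of `L` at `z`, whose last axis points from `z` to `x`, the boundary of `Ω` is a
paraboloid of principal curvatures `κ` up to second order. -/
structure IsTouchingFrame {N n : ℕ} (Ω : Set (E N)) (x z : E N) (R : ℝ) (κ : Fin n → ℝ)
    (L : E N ≃ₗᵢ[ℝ] WithLp 2 (E n × ℝ)) : Prop where
  isOpen : IsOpen Ω
  pos : 0 < R
  sub_eq : x - z = R • frameNormal L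
  subset : Metric.closedBall x R \ {z} ⊆ Ω
  curv_lt : ∀ j, κ j < 1 / R
  flat : ∀ η > 0, ∃ ρ > 0,
    (∀ y ∈ frontier Ω ∩ Metric.closedBall z ρ,
      paraboloid (frameNormal L) (frameTangent L) κ η z y ≤ 0) ∧
    (∀ y ∈ closure Ω ∩ Metric.closedBall z ρ,
      0 ≤ paraboloid (frameNormal L) (frameTangent L) κ (-η) z y)

theorem tendsto_id_nhdsGT : Tendsto (fun ε : ℝ => ε) (𝓝[>] 0) (𝓝 0) :=
  tendsto_id.mono_left nhdsWithin_le_nhds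

/-- The rate of the localizing exponential can be taken proportional to `1 / ε`. -/
theorem exists_rate (C r : ℝ) : ∃ β > 0, ∀ᶠ ε : ℝ in 𝓝[>] 0,
    ε ^ 2 * (C * (4 * (β / ε) ^ 2 * r ^ 2 + 2 * (β / ε))) < 1 := by
  have h1 : Tendsto (fun β : ℝ => C * (4 * β ^ 2 * r ^ 2)) (𝓝[>] 0) (𝓝 0) := by
    have h : Continuous (fun β : ℝ => C * (4 * β ^ 2 * r ^ 2)) := by fun_prop
    simpa using (h.tendsto 0).mono_left nhdsWithin_le_nhds
  obtain ⟨β, hβ, hβ0⟩ := ((h1.eventually (gt_mem_nhds one_pos)).and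
    eventually_mem_nhdsWithin).exists
  refine ⟨β, hβ0, ?_⟩
  have h2 : Tendsto (fun ε : ℝ => C * (4 * β ^ 2 * r ^ 2 + 2 * β * ε)) (𝓝[>] 0)
      (𝓝 (C * (4 * β ^ 2 * r ^ 2))) := by
    have h : Continuous (fun ε : ℝ => C * (4 * β ^ 2 * r ^ 2 + 2 * β * ε)) := by fun_prop
    simpa using (h.tendsto 0).mono_left nhdsWithin_le_nhds
  filter_upwards [h2.eventually (gt_mem_nhds hβ), eventually_mem_nhdsWithin] with ε hε hε0
  have hne : ε ≠ 0 := ne_of_gt hε0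
  refine lt_of_eq_of_lt ?_ hε
  field_simp

section Local

variable {N n : ℕ} {M : SymMat N → ℝ} {θ C R : ℝ} {Ω : Set (E N)} {u : ℝ → E N → ℝ} {x z : E N}
  {κ : Fin n → ℝ} {L : E N ≃ₗᵢ[ℝ] WithLp 2 (E n × ℝ)}

theorem exists_le_exp_of_closedBall_subset (hM : IsRankOneStable θ C M) (hθ : 0 < θ) (hC : 0 ≤ C)
    (hΩ : IsOpen Ω) (hu : ∀ ε > 0, IsSolution M ε Ω (u ε)) {ν : E N} (hν : ‖ν‖ = 1) {s : ℝ}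
    (hs : 0 ≤ s) :
    ∃ β > 0, ∀ᶠ ε : ℝ in 𝓝[>] 0, ∀ y, Metric.closedBall y s ⊆ Ω →
      u ε y ≤ Real.exp (-(β / ε) * s ^ 2) := by
  obtain ⟨β, hβ, h⟩ := exists_rate C s
  refine ⟨β, hβ, ?_⟩
  filter_upwards [h, eventually_mem_nhdsWithin] with ε hε hε0 y hy
  have hε0' : 0 < ε := hε0
  have h1 := (hu ε hε0).le_expBarrier (n := 0) (ν := ν)
    (e := fun _ => 0) (α := 0) (a := 0) (b := β / ε) (z := y) (r := s) (fun _ => 0) 0 hM hθ.le hC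
    hΩ hν (fun j => j.elim0) le_rfl le_rfl (by positivity) (by simp) hε
    (fun w hw => absurd (hy hw.2) (by
      have := hw.1.2
      rwa [hΩ.interior_eq] at this)) y
    ⟨subset_closure (hy (Metric.mem_closedBall_self hs)), Metric.mem_closedBall_self hs⟩
  refine h1.trans (le_of_eq ?_)
  simp [expBarrier]

/-- Upper bound by the exponential profile of a slightly slower rate, `τ < 1`. -/
theorem exists_le_profile (hM : IsRankOneStable θ C M) (hθ : 0 < θ) (hC : 0 ≤ C)
    (hu : ∀ ε > 0, IsSolution M ε Ω (u ε)) (hF : IsTouchingFrame Ω x z R κ L)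
    {τ η : ℝ} (hτ0 : 0 < τ) (hτ : τ < 1) (hη : 0 < η) :
    ∃ ρ > 0, ∃ β > 0, ∀ᶠ ε : ℝ in 𝓝[>] 0, ∀ y ∈ closure Ω ∩ Metric.closedBall z ρ,
      u ε y ≤ Real.exp (-(τ / (√θ * ε)) * paraboloid (frameNormal L) (frameTangent L) κ η z y) +
        Real.exp (β / ε * (‖y - z‖ ^ 2 - ρ ^ 2)) := by
  obtain ⟨ρ₀, hρ₀, hout, -⟩ := hF.flat η hη
  have hc : Tendsto (fun ρ : ℝ => τ ^ 2 * (1 + 2 * curvBound κ η * ρ) ^ 2) (𝓝[>] 0)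
      (𝓝 (τ ^ 2)) := by
    have h : Continuous (fun ρ : ℝ => τ ^ 2 * (1 + 2 * curvBound κ η * ρ) ^ 2) := by fun_prop
    simpa using (h.tendsto 0).mono_left nhdsWithin_le_nhds
  obtain ⟨ρ, ⟨hρ1, hρ2⟩, hρ3⟩ := ((hc.eventually (gt_mem_nhds (by nlinarith : τ ^ 2 < 1))).and
    eventually_mem_nhdsWithin).and (tendsto_id_nhdsGT.eventually (gt_mem_nhds hρ₀)) |>.exists
  obtain ⟨β, hβ, h⟩ := exists_rate C ρ
  refine ⟨ρ, hρ2, β, hβ, ?_⟩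
  have hsθ : 0 < √θ := Real.sqrt_pos.2 hθ
  have hlim : Tendsto (fun ε : ℝ => τ ^ 2 * (1 + 2 * curvBound κ η * ρ) ^ 2 +
      C * (2 * (τ / √θ) * curvBound κ η) * ε) (𝓝[>] 0)
      (𝓝 (τ ^ 2 * (1 + 2 * curvBound κ η * ρ) ^ 2)) := by
    have h : Continuous (fun ε : ℝ => τ ^ 2 * (1 + 2 * curvBound κ η * ρ) ^ 2 +
      C * (2 * (τ / √θ) * curvBound κ η) * ε) := by fun_prop
    simpa using (h.tendsto 0).mono_left nhdsWithin_le_nhds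
  filter_upwards [h, hlim.eventually (gt_mem_nhds hρ1), eventually_mem_nhdsWithin]
    with ε hε hε1 hε0 y hy
  have hε0' : 0 < ε := hε0
  have h1 := (hu ε hε0).le_expBarrier (α := 1) (a := τ / (√θ * ε)) (b := β / ε) κ η hM hθ.le hC
    hF.isOpen (norm_frameNormal L) (norm_frameTangent L) zero_le_one (by positivity)
    (by positivity) ?_ hε ?_ y hy
  · simpa [expBarrier] using h1
  · refine le_of_eq_of_le ?_ hε1.le
    have : √θ ^ 2 = θ := Real.sq_sqrt hθ.le
    field_simp
    linear_combination -(τ * (1 + 2 * curvBound κ η * ρ) ^ 2) * this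
  · intro w hw
    have h2 := hout w ⟨hw.1, Metric.closedBall_subset_closedBall (le_of_lt hρ3) hw.2⟩
    have h3 : 1 ≤ Real.exp (-(τ / (√θ * ε)) *
        paraboloid (frameNormal L) (frameTangent L) κ η z w) := by
      refine Real.one_le_exp ?_
      have : 0 ≤ τ / (√θ * ε) := by positivity
      nlinarith
    have h4 := Real.exp_pos (β / ε * (‖w - z‖ ^ 2 - ρ ^ 2))
    unfold expBarrier
    linarith

/-- Lower bound by the exponential profile of a slightly faster rate, `τ > 1`. -/
theorem exists_profile_le (hM : IsRankOneStable θ C M) (hθ : 0 < θ) (hC : 0 ≤ C)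
    (hu : ∀ ε > 0, IsSolution M ε Ω (u ε)) (hF : IsTouchingFrame Ω x z R κ L)
    {τ η : ℝ} (hτ : 1 < τ) (hη : 0 < η) :
    ∃ ρ > 0, ∃ β > 0, ∀ᶠ ε : ℝ in 𝓝[>] 0, ∀ y ∈ closure Ω ∩ Metric.closedBall z ρ,
      Real.exp (-(τ / (√θ * ε)) * paraboloid (frameNormal L) (frameTangent L) κ (-η) z y) -
        Real.exp (β / ε * (‖y - z‖ ^ 2 - ρ ^ 2)) ≤ u ε y := by
  obtain ⟨ρ₀, hρ₀, -, hin⟩ := hF.flat η hη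
  have hc : Tendsto (fun ρ : ℝ => τ ^ 2 * (1 - 2 * curvBound κ (-η) * ρ) ^ 2) (𝓝[>] 0)
      (𝓝 (τ ^ 2)) := by
    have h : Continuous (fun ρ : ℝ => τ ^ 2 * (1 - 2 * curvBound κ (-η) * ρ) ^ 2) := by fun_prop
    simpa using (h.tendsto 0).mono_left nhdsWithin_le_nhds
  have hc' : Tendsto (fun ρ : ℝ => 2 * curvBound κ (-η) * ρ) (𝓝[>] 0) (𝓝 0) := by
    have h : Continuous (fun ρ : ℝ => 2 * curvBound κ (-η) * ρ) := by fun_prop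
    simpa using (h.tendsto 0).mono_left nhdsWithin_le_nhds
  obtain ⟨ρ, ⟨⟨hρ1, hρ2⟩, hρ3⟩, hρ4⟩ :=
    (((hc.eventually (lt_mem_nhds (by nlinarith : 1 < τ ^ 2))).and
      eventually_mem_nhdsWithin).and (tendsto_id_nhdsGT.eventually (gt_mem_nhds hρ₀))).and
      (hc'.eventually (gt_mem_nhds one_pos)) |>.exists
  obtain ⟨β, hβ, h⟩ := exists_rate C ρ
  refine ⟨ρ, hρ2, β, hβ, ?_⟩
  have hsθ : 0 < √θ := Real.sqrt_pos.2 hθ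
  have hlim : Tendsto (fun ε : ℝ => τ ^ 2 * (1 - 2 * curvBound κ (-η) * ρ) ^ 2 -
      C * (2 * (τ / √θ) * curvBound κ (-η)) * ε) (𝓝[>] 0)
      (𝓝 (τ ^ 2 * (1 - 2 * curvBound κ (-η) * ρ) ^ 2)) := by
    have h : Continuous (fun ε : ℝ => τ ^ 2 * (1 - 2 * curvBound κ (-η) * ρ) ^ 2 -
      C * (2 * (τ / √θ) * curvBound κ (-η)) * ε) := by fun_prop
    simpa using (h.tendsto 0).mono_left nhdsWithin_le_nhds
  filter_upwards [h, hlim.eventually (lt_mem_nhds hρ1), eventually_mem_nhdsWithin]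
    with ε hε hε1 hε0 y hy
  have hε0' : 0 < ε := hε0
  have h1 := (hu ε hε0).expBarrier_le (a := τ / (√θ * ε)) (b := β / ε) κ (-η) hM hθ.le hC
    hF.isOpen (norm_frameNormal L) (norm_frameTangent L) (by positivity)
    (by positivity) hρ4.le ?_ hε
    (fun w hw => hin w ⟨hw.1, Metric.closedBall_subset_closedBall (le_of_lt hρ3) hw.2⟩) y hy
  · simpa [expBarrier, sub_eq_add_neg] using h1
  · refine hε1.le.trans_eq ?_
    have : √θ ^ 2 = θ := Real.sq_sqrt hθ.le
    field_simp
    linear_combination τ * (1 - 2 * curvBound κ (-η) * ρ) ^ 2 * this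

end Local

section Decay

variable {N n : ℕ} {M : SymMat N → ℝ} {θ C R : ℝ} {Ω : Set (E N)} {u : ℝ → E N → ℝ} {x z : E N}
  {κ : Fin n → ℝ} {L : E N ≃ₗᵢ[ℝ] WithLp 2 (E n × ℝ)}

theorem IsTouchingFrame.mem_ball_iff (hF : IsTouchingFrame Ω x z R κ L) (w : E N) :
    z + w ∈ Metric.ball x R ↔ ‖w‖ ^ 2 < 2 * R * (L w).snd := by
  have h1 : z + w - x = w - R • frameNormal L := by
    rw [← hF.sub_eq]
    abel
  have h2 : ‖z + w - x‖ ^ 2 = ‖w‖ ^ 2 - 2 * R * (L w).snd + R ^ 2 := by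
    rw [h1, norm_sub_sq_real, inner_smul_right, real_inner_comm, inner_frameNormal, norm_smul,
      norm_frameNormal, mul_one, Real.norm_eq_abs, sq_abs]
    ring
  rw [Metric.mem_ball, dist_eq_norm, ← abs_of_pos hF.pos, ← abs_norm, ← sq_lt_sq,
    abs_of_pos hF.pos, h2]
  constructor <;> intro h <;> linarith

theorem IsTouchingFrame.ball_subset (hF : IsTouchingFrame Ω x z R κ L) :
    Metric.ball x R ⊆ Ω := by
  intro y hy
  refine hF.subset ⟨Metric.ball_subset_closedBall hy, ?_⟩
  rintro rfl
  have := (hF.mem_ball_iff 0).1 (by simpa using hy)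
  simp at this

theorem IsTouchingFrame.snd_pos (hF : IsTouchingFrame Ω x z R κ L) {y : E N}
    (hy : y ∈ Metric.ball x R) : 0 < (L (y - z)).snd := by
  have h := (hF.mem_ball_iff (y - z)).1 (by simpa using hy)
  have h1 := sq_nonneg ‖y - z‖
  have h2 := hF.pos
  by_contra h3
  nlinarith

theorem sum_sq_fst_le_norm_sq (L : E N ≃ₗᵢ[ℝ] WithLp 2 (E n × ℝ)) (w : E N) :
    ∑ j, ((L w).fst j) ^ 2 ≤ ‖w‖ ^ 2 := by
  rw [norm_sq_eq_frame L, EuclideanSpace.real_norm_sq_eq]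
  linarith [sq_nonneg (L w).snd]

/-- As the principal curvatures are smaller than `1 / R`, inside the ball of radius `R` the
paraboloid is comparable with the height over the tangent plane. -/
theorem IsTouchingFrame.exists_snd_le_paraboloid (hF : IsTouchingFrame Ω x z R κ L) :
    ∃ η > 0, ∃ δ > 0, ∀ y ∈ Metric.ball x R,
      δ * (L (y - z)).snd ≤ paraboloid (frameNormal L) (frameTangent L) κ η z y := by
  have hR := hF.pos
  obtain ⟨c, ⟨hc, hc0⟩, hc1⟩ : ∃ c, ((∀ j, κ j < c) ∧ 0 < c) ∧ c < 1 / R := by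
    have h1 : ∀ᶠ c in 𝓝[<] (1 / R), ∀ j, κ j < c := Filter.eventually_all.2 fun j =>
      (lt_mem_nhds (hF.curv_lt j)).filter_mono nhdsWithin_le_nhds
    have h2 : ∀ᶠ c in 𝓝[<] (1 / R), 0 < c :=
      (lt_mem_nhds (by positivity)).filter_mono nhdsWithin_le_nhds
    exact ((h1.and h2).and eventually_mem_nhdsWithin).exists
  have hcR : c * R < 1 := by rwa [lt_div_iff₀ hR] at hc1
  refine ⟨(1 - c * R) / (4 * R), div_pos (by linarith) (by positivity), (1 - c * R) / 2,
    by linarith, fun y hy => ?_⟩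
  have hy' := (hF.mem_ball_iff (y - z)).1 (by simpa using hy)
  have h0 := hF.snd_pos hy
  have h1 := paraboloid_frame L κ ((1 - c * R) / (4 * R)) z (y - z)
  rw [add_sub_cancel] at h1
  rw [h1]
  set w := y - z
  have h2 : ∑ j, κ j * ((L w).fst j) ^ 2 ≤ c * ‖w‖ ^ 2 := by
    refine le_trans ?_ (mul_le_mul_of_nonneg_left (sum_sq_fst_le_norm_sq L w) hc0.le)
    rw [Finset.mul_sum]
    exact Finset.sum_le_sum fun j _ => mul_le_mul_of_nonneg_right (hc j).le (sq_nonneg _)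
  have h3 : (1 - c * R) / (4 * R) * ‖w‖ ^ 2 ≤ (1 - c * R) / 2 * (L w).snd := by
    have := mul_le_mul_of_nonneg_left hy'.le
      (div_nonneg (by linarith) (by positivity) : 0 ≤ (1 - c * R) / (4 * R))
    refine this.trans_eq ?_
    field_simp
    ring
  have h4 := mul_le_mul_of_nonneg_left hy'.le hc0.le
  linarith

/-- In the ball of radius `R` the solutions decay exponentially in the height over the tangent plane
at the touching point, with a rate of the order of `1 / ε`. -/
theorem exists_exp_decay (hM : IsRankOneStable θ C M) (hθ : 0 < θ) (hC : 0 ≤ C)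
    (hu : ∀ ε > 0, IsSolution M ε Ω (u ε)) (hF : IsTouchingFrame Ω x z R κ L) :
    ∃ k > 0, ∀ᶠ ε : ℝ in 𝓝[>] 0, ∀ y ∈ Metric.ball x R,
      u ε y ≤ 2 * Real.exp (-(k / ε * (L (y - z)).snd)) := by
  have hR := hF.pos
  have hsθ : 0 < √θ := Real.sqrt_pos.2 hθ
  obtain ⟨η, hη, δ, hδ, hpar⟩ := hF.exists_snd_le_paraboloid
  obtain ⟨ρ, hρ, β, hβ, hnear⟩ := exists_le_profile (τ := 1 / 2) hM hθ hC hu hF (by norm_num)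
    (by norm_num) hη
  -- away from `z` the points of the ball have a positive distance to the complement of `Ω`
  have hcomp : IsCompact (Metric.closedBall x R \ Metric.ball z (ρ / 2)) :=
    (isCompact_closedBall x R).diff Metric.isOpen_ball
  have hsub : Metric.closedBall x R \ Metric.ball z (ρ / 2) ⊆ Ω := by
    intro y hy
    refine hF.subset ⟨hy.1, ?_⟩
    rintro rfl
    exact hy.2 (Metric.mem_ball_self (by positivity))
  obtain ⟨s, hs, hthick⟩ := hcomp.exists_cthickening_subset_open hF.isOpen hsub
  obtain ⟨β', hβ', hfar⟩ := exists_le_exp_of_closedBall_subset hM hθ hC hF.isOpen hu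
    (norm_frameNormal L) hs.le
  set k := min (min (δ / (2 * √θ)) (β * (3 / 4) * ρ)) (β' * s ^ 2 / (2 * R)) with hk
  have hk0 : 0 < k := by
    rw [hk]
    refine lt_min (lt_min ?_ ?_) ?_ <;> positivity
  have hk1 : k ≤ δ / (2 * √θ) := (min_le_left _ _).trans (min_le_left _ _)
  have hk2 : k ≤ β * (3 / 4) * ρ := (min_le_left _ _).trans (min_le_right _ _)
  have hk3 : k ≤ β' * s ^ 2 / (2 * R) := min_le_right _ _
  refine ⟨k, hk0, ?_⟩
  filter_upwards [hnear, hfar, eventually_mem_nhdsWithin] with ε h1 h2 hε y hy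
  have hε' : 0 < ε := hε
  have hpos := hF.snd_pos hy
  have hw := (hF.mem_ball_iff (y - z)).1 (by simpa using hy)
  set t := (L (y - z)).snd with ht
  have htw : t ≤ ‖y - z‖ := by
    refine le_of_sq_le_sq ?_ (norm_nonneg _)
    rw [norm_sq_eq_frame L]
    linarith [sq_nonneg ‖(L (y - z)).fst‖]
  by_cases hyz : y ∈ Metric.ball z (ρ / 2)
  · rw [Metric.mem_ball, dist_eq_norm] at hyz
    refine (h1 y ⟨subset_closure (hF.ball_subset hy), ?_⟩).trans ?_
    · rw [Metric.mem_closedBall, dist_eq_norm]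
      linarith
    have h3 : k / ε * t ≤ 1 / 2 / (√θ * ε) *
        paraboloid (frameNormal L) (frameTangent L) κ η z y := by
      have h4 := mul_le_mul_of_nonneg_left (hpar y hy)
        (by positivity : 0 ≤ 1 / 2 / (√θ * ε))
      refine le_trans ?_ h4
      have h5 : 1 / 2 / (√θ * ε) * (δ * t) = δ / (2 * √θ) / ε * t := by field_simp
      rw [h5]
      gcongr
    have h6 : k / ε * t ≤ -(β / ε * (‖y - z‖ ^ 2 - ρ ^ 2)) := by
      have h7 : k / ε * t ≤ β * (3 / 4) * ρ / ε * ρ := by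
        gcongr
        linarith
      refine h7.trans ?_
      have h8 : ‖y - z‖ ^ 2 ≤ (ρ / 2) ^ 2 := pow_le_pow_left₀ (norm_nonneg _) hyz.le 2
      have h9 := mul_le_mul_of_nonneg_left h8 (by positivity : 0 ≤ β / ε)
      have : β * (3 / 4) * ρ / ε * ρ = β / ε * (3 / 4 * ρ ^ 2) := by ring
      rw [this]
      linarith
    have h10 : Real.exp (-(1 / 2 / (√θ * ε)) *
        paraboloid (frameNormal L) (frameTangent L) κ η z y) ≤ Real.exp (-(k / ε * t)) :=
      Real.exp_le_exp.2 (by linarith)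
    have h11 : Real.exp (β / ε * (‖y - z‖ ^ 2 - ρ ^ 2)) ≤ Real.exp (-(k / ε * t)) :=
      Real.exp_le_exp.2 (by linarith)
    linarith
  · have hyK : y ∈ Metric.closedBall x R \ Metric.ball z (ρ / 2) :=
      ⟨Metric.ball_subset_closedBall hy, hyz⟩
    refine (h2 y ((Metric.closedBall_subset_cthickening hyK s).trans hthick)).trans ?_
    · have h3 : Real.exp (-(β' / ε) * s ^ 2) ≤ Real.exp (-(k / ε * t)) := by
        refine Real.exp_le_exp.2 ?_
        have h4 : t ≤ 2 * R := by nlinarith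
        have h5 : k / ε * t ≤ β' * s ^ 2 / (2 * R) / ε * (2 * R) := by gcongr
        have h6 : β' * s ^ 2 / (2 * R) / ε * (2 * R) = β' / ε * s ^ 2 := by field_simp
        linarith
      linarith [Real.exp_pos (-(k / ε * t))]

/-- The point with coordinates `√ε v` and `ε t` in the frame of `L` at `z`: a ball touching at `z`
becomes a paraboloid in the coordinates `(v, t)`. -/
noncomputable def blowUp (L : E N ≃ₗᵢ[ℝ] WithLp 2 (E n × ℝ)) (z : E N) (ε : ℝ) (p : E n × ℝ) :
    E N :=
  z + L.symm (WithLp.toLp 2 (√ε • p.1, ε * p.2))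

theorem norm_blowUp_sub_sq {ε : ℝ} (hε : 0 ≤ ε) (p : E n × ℝ) :
    ‖blowUp L z ε p - z‖ ^ 2 = ε * ‖p.1‖ ^ 2 + ε ^ 2 * p.2 ^ 2 := by
  rw [norm_sq_eq_frame L]
  simp [blowUp, norm_smul, mul_pow, Real.sq_sqrt hε]

theorem paraboloid_blowUp {ε : ℝ} (hε : 0 ≤ ε) (η : ℝ) (p : E n × ℝ) :
    paraboloid (frameNormal L) (frameTangent L) κ η z (blowUp L z ε p) =
      ε * (p.2 - (∑ j, κ j * (p.1 j) ^ 2) / 2 - η * (‖p.1‖ ^ 2 + ε * p.2 ^ 2)) := by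
  have h1 : ‖L.symm (WithLp.toLp 2 (√ε • p.1, ε * p.2))‖ ^ 2 = ε * ‖p.1‖ ^ 2 + ε ^ 2 * p.2 ^ 2 := by
    have := norm_blowUp_sub_sq (L := L) (z := z) hε p
    simpa [blowUp] using this
  unfold blowUp
  rw [paraboloid_frame, h1]
  have h2 : ∑ j, κ j * (√ε * p.1 j) ^ 2 = ε * ∑ j, κ j * (p.1 j) ^ 2 := by
    rw [Finset.mul_sum]
    refine Finset.sum_congr rfl fun j _ => ?_
    rw [mul_pow, Real.sq_sqrt hε]
    ring
  simp [h2]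
  ring

theorem IsTouchingFrame.blowUp_mem_ball_iff (hF : IsTouchingFrame Ω x z R κ L) {ε : ℝ} (hε : 0 < ε)
    (p : E n × ℝ) :
    blowUp L z ε p ∈ Metric.ball x R ↔ ‖p.1‖ ^ 2 + ε * p.2 ^ 2 < 2 * R * p.2 := by
  have h1 := norm_blowUp_sub_sq (L := L) (z := z) hε.le p
  have h2 : blowUp L z ε p = z + (blowUp L z ε p - z) := by abel
  rw [h2, hF.mem_ball_iff, h1]
  have h3 : (L (blowUp L z ε p - z)).snd = ε * p.2 := by simp [blowUp]
  rw [h3]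
  constructor <;> intro h
  · refine lt_of_mul_lt_mul_left ?_ hε.le
    linarith
  · nlinarith

theorem tendsto_exp_localization {β ρ : ℝ} (hβ : 0 < β) (hρ : 0 < ρ) (p : E n × ℝ) :
    Tendsto (fun ε : ℝ => Real.exp (β / ε * (‖blowUp L z ε p - z‖ ^ 2 - ρ ^ 2))) (𝓝[>] 0)
      (𝓝 0) := by
  refine Real.tendsto_exp_atBot.comp ?_
  have h1 : Tendsto (fun ε : ℝ => β * (‖p.1‖ ^ 2 + ε * p.2 ^ 2)) (𝓝[>] 0)
      (𝓝 (β * (‖p.1‖ ^ 2 + 0 * p.2 ^ 2))) := by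
    have h : Continuous (fun ε : ℝ => β * (‖p.1‖ ^ 2 + ε * p.2 ^ 2)) := by fun_prop
    exact (h.tendsto 0).mono_left nhdsWithin_le_nhds
  have h2 : Tendsto (fun ε : ℝ => (β * ρ ^ 2) * ε⁻¹) (𝓝[>] 0) atTop :=
    tendsto_inv_nhdsGT_zero.const_mul_atTop (by positivity)
  refine (h1.add_atBot (tendsto_neg_atTop_atBot.comp h2)).congr' ?_
  filter_upwards [eventually_mem_nhdsWithin] with ε hε
  have hε' : (0 : ℝ) < ε := hε
  rw [norm_blowUp_sub_sq hε'.le]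
  simp only [Function.comp_apply]
  field_simp
  ring

theorem tendsto_blowUp (p : E n × ℝ) :
    Tendsto (fun ε : ℝ => blowUp L z ε p) (𝓝[>] 0) (𝓝 z) := by
  rw [tendsto_iff_norm_sub_tendsto_zero]
  have h1 : Tendsto (fun ε : ℝ => √(ε * ‖p.1‖ ^ 2 + ε ^ 2 * p.2 ^ 2)) (𝓝[>] 0) (𝓝 0) := by
    have h : Continuous (fun ε : ℝ => √(ε * ‖p.1‖ ^ 2 + ε ^ 2 * p.2 ^ 2)) := by fun_prop
    simpa using (h.tendsto 0).mono_left nhdsWithin_le_nhds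
  refine h1.congr' ?_
  filter_upwards [eventually_mem_nhdsWithin] with ε hε
  rw [← norm_blowUp_sub_sq (L := L) (z := z) (le_of_lt hε) p, Real.sqrt_sq (norm_nonneg _)]

/-- Convergence of the rescaled solutions to an exponential profile. -/
theorem tendsto_solution_blowUp (hM : IsRankOneStable θ C M) (hθ : 0 < θ) (hC : 0 ≤ C)
    (hu : ∀ ε > 0, IsSolution M ε Ω (u ε)) (hF : IsTouchingFrame Ω x z R κ L) (p : E n × ℝ)
    (hp : ‖p.1‖ ^ 2 < 2 * R * p.2) :
    Tendsto (fun ε : ℝ => u ε (blowUp L z ε p)) (𝓝[>] 0)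
      (𝓝 (Real.exp (-((p.2 - (∑ j, κ j * (p.1 j) ^ 2) / 2) / √θ)))) := by
  have hsθ : 0 < √θ := Real.sqrt_pos.2 hθ
  set q := (∑ j, κ j * (p.1 j) ^ 2) / 2 with hq
  have hball : ∀ᶠ ε : ℝ in 𝓝[>] 0, blowUp L z ε p ∈ Metric.ball x R := by
    have h1 : Tendsto (fun ε : ℝ => ‖p.1‖ ^ 2 + ε * p.2 ^ 2) (𝓝[>] 0) (𝓝 (‖p.1‖ ^ 2)) := by
      have h : Continuous (fun ε : ℝ => ‖p.1‖ ^ 2 + ε * p.2 ^ 2) := by fun_prop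
      simpa using (h.tendsto 0).mono_left nhdsWithin_le_nhds
    filter_upwards [h1.eventually (gt_mem_nhds hp), eventually_mem_nhdsWithin] with ε h2 hε
    exact (hF.blowUp_mem_ball_iff hε p).2 h2
  have hcl : ∀ ρ > 0, ∀ᶠ ε : ℝ in 𝓝[>] 0,
      blowUp L z ε p ∈ closure Ω ∩ Metric.closedBall z ρ := by
    intro ρ hρ
    filter_upwards [hball, (tendsto_blowUp p).eventually (Metric.closedBall_mem_nhds z hρ)]
      with ε h1 h2
    exact ⟨subset_closure (hF.ball_subset h1), h2⟩
  have hprof : ∀ τ η : ℝ, Tendsto (fun ε : ℝ => Real.exp (-(τ / (√θ * ε)) *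
      paraboloid (frameNormal L) (frameTangent L) κ η z (blowUp L z ε p))) (𝓝[>] 0)
      (𝓝 (Real.exp (-(τ / √θ) * (p.2 - q - η * ‖p.1‖ ^ 2)))) := by
    intro τ η
    have h1 : Tendsto (fun ε : ℝ => Real.exp (-(τ / √θ) *
        (p.2 - q - η * (‖p.1‖ ^ 2 + ε * p.2 ^ 2)))) (𝓝[>] 0)
        (𝓝 (Real.exp (-(τ / √θ) * (p.2 - q - η * ‖p.1‖ ^ 2)))) := by
      have h : Continuous (fun ε : ℝ => Real.exp (-(τ / √θ) *
        (p.2 - q - η * (‖p.1‖ ^ 2 + ε * p.2 ^ 2)))) := by fun_prop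
      simpa using (h.tendsto 0).mono_left nhdsWithin_le_nhds
    refine h1.congr' ?_
    filter_upwards [eventually_mem_nhdsWithin] with ε hε
    have hε' : (0 : ℝ) < ε := hε
    rw [paraboloid_blowUp hε'.le, ← hq]
    clear_value q
    congr 1
    field_simp
  refine tendsto_order.2 ⟨fun b hb => ?_, fun b hb => ?_⟩
  · have hcont : Tendsto (fun η : ℝ => Real.exp (-((1 + η) / √θ) *
        (p.2 - q - (-η) * ‖p.1‖ ^ 2))) (𝓝[>] 0) (𝓝 (Real.exp (-((p.2 - q) / √θ)))) := by
      have h : Continuous (fun η : ℝ => Real.exp (-((1 + η) / √θ) *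
        (p.2 - q - (-η) * ‖p.1‖ ^ 2))) := by fun_prop
      convert (h.tendsto 0).mono_left nhdsWithin_le_nhds using 3
      simp
      ring
    obtain ⟨η, hη, hη0⟩ := ((hcont.eventually (lt_mem_nhds hb)).and
      eventually_mem_nhdsWithin).exists
    have hη0' : (0 : ℝ) < η := hη0
    obtain ⟨ρ, hρ, β, hβ, hle⟩ := exists_profile_le (τ := 1 + η) hM hθ hC hu hF (by linarith) hη0
    have hlim := (hprof (1 + η) (-η)).sub
      (tendsto_exp_localization (L := L) (z := z) hβ hρ p)
    rw [sub_zero] at hlim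
    filter_upwards [hlim.eventually (lt_mem_nhds hη), hle, hcl ρ hρ] with ε h1 h2 h3
    exact h1.trans_le (h2 _ h3)
  · have hcont : Tendsto (fun η : ℝ => Real.exp (-((1 - η) / √θ) *
        (p.2 - q - η * ‖p.1‖ ^ 2))) (𝓝[>] 0) (𝓝 (Real.exp (-((p.2 - q) / √θ)))) := by
      have h : Continuous (fun η : ℝ => Real.exp (-((1 - η) / √θ) *
        (p.2 - q - η * ‖p.1‖ ^ 2))) := by fun_prop
      convert (h.tendsto 0).mono_left nhdsWithin_le_nhds using 3
      simp
      ring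
    obtain ⟨η, ⟨hη, hη0⟩, hη1⟩ := ((hcont.eventually (gt_mem_nhds hb)).and
      eventually_mem_nhdsWithin).and (tendsto_id_nhdsGT.eventually (gt_mem_nhds one_pos)) |>.exists
    have hη0' : (0 : ℝ) < η := hη0
    obtain ⟨ρ, hρ, β, hβ, hle⟩ := exists_le_profile (τ := 1 - η) hM hθ hC hu hF (by linarith)
      (by linarith) hη0
    have hlim := (hprof (1 - η) η).add
      (tendsto_exp_localization (L := L) (z := z) hβ hρ p)
    rw [add_zero] at hlim
    filter_upwards [hlim.eventually (gt_mem_nhds hη), hle, hcl ρ hρ] with ε h1 h2 h3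
    exact (h2 _ h3).trans_lt h1

end Decay

/-! ### Gaussian integrals and the change of variables -/

theorem exp_neg_sum_eq_prod {n : ℕ} (b : Fin n → ℝ) (v : Fin n → ℝ) :
    Real.exp (-∑ j, b j * v j ^ 2) = ∏ j, Real.exp (-b j * v j ^ 2) := by
  rw [← Real.exp_sum, ← Finset.sum_neg_distrib]
  simp

theorem integrable_gaussian_euclidean {n : ℕ} {b : Fin n → ℝ} (hb : ∀ j, 0 < b j) :
    Integrable (fun v : E n => Real.exp (-∑ j, b j * v j ^ 2)) := by
  have h : Integrable (fun v : Fin n → ℝ => ∏ j, Real.exp (-b j * v j ^ 2)) :=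
    Integrable.fintype_prod (f := fun j t => Real.exp (-b j * t ^ 2))
      fun j => integrable_exp_neg_mul_sq (hb j)
  have h2 := (PiLp.volume_preserving_ofLp (Fin n)).integrable_comp_of_integrable h
  refine h2.congr (ae_of_all _ fun v => ?_)
  simp only [Function.comp_apply, exp_neg_sum_eq_prod]

theorem integral_gaussian_euclidean {n : ℕ} (b : Fin n → ℝ) :
    ∫ v : E n, Real.exp (-∑ j, b j * v j ^ 2) = ∏ j, √(Real.pi / b j) := by
  have h := (EuclideanSpace.volume_preserving_symm_measurableEquiv_toLp (Fin n)).integral_comp'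
    (fun v : Fin n → ℝ => Real.exp (-∑ j, b j * v j ^ 2))
  refine Eq.trans h ?_
  simp only [exp_neg_sum_eq_prod]
  rw [integral_fintype_prod_volume_eq_prod (f := fun j t => Real.exp (-b j * t ^ 2))]
  exact Finset.prod_congr rfl fun j _ => integral_gaussian _

section ChangeOfVariables

variable {N n : ℕ} (L : E N ≃ₗᵢ[ℝ] WithLp 2 (E n × ℝ)) (z : E N)

theorem map_scaling {ε : ℝ} (hε : 0 < ε) :
    Measure.map (fun p : E n × ℝ => (√ε • p.1, ε * p.2)) volume =
      ENNReal.ofReal ((√ε ^ n * ε)⁻¹) • (volume : Measure (E n × ℝ)) := by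
  have hs : 0 < √ε := Real.sqrt_pos.2 hε
  have h1 : Measure.map (fun v : E n => √ε • v) volume =
      ENNReal.ofReal ((√ε ^ n)⁻¹) • (volume : Measure (E n)) := by
    have := Measure.map_addHaar_smul (volume : Measure (E n)) hs.ne'
    rwa [finrank_euclideanSpace_fin, abs_of_pos (by positivity)] at this
  have h2 : Measure.map (fun t : ℝ => ε * t) volume =
      ENNReal.ofReal (ε⁻¹) • (volume : Measure ℝ) := by
    have := Measure.map_addHaar_smul (volume : Measure ℝ) hε.ne'
    simpa [abs_of_pos hε] using this
  have h3 := Measure.map_prod_map (volume : Measure (E n)) (volume : Measure ℝ)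
    (f := fun v : E n => √ε • v) (g := fun t : ℝ => ε * t) (by fun_prop) (by fun_prop)
  rw [Measure.volume_eq_prod]
  refine h3.symm.trans ?_
  rw [h1, h2, Measure.prod_smul_left, Measure.prod_smul_right, smul_smul,
    ← ENNReal.ofReal_mul (by positivity), mul_inv]

theorem map_blowUp {ε : ℝ} (hε : 0 < ε) :
    Measure.map (blowUp L z ε) volume =
      ENNReal.ofReal ((√ε ^ n * ε)⁻¹) • (volume : Measure (E N)) := by
  have h1 : MeasurePreserving (fun p : E n × ℝ => z + L.symm (WithLp.toLp 2 p)) :=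
    (measurePreserving_add_left volume z).comp
      (L.symm.measurePreserving.comp (WithLp.volume_preserving_toLp (E n) ℝ))
  have h2 : blowUp L z ε = (fun p : E n × ℝ => z + L.symm (WithLp.toLp 2 p)) ∘
      (fun p : E n × ℝ => (√ε • p.1, ε * p.2)) := rfl
  rw [h2, ← Measure.map_map h1.measurable (by fun_prop), map_scaling hε, Measure.map_smul, h1.map_eq]

theorem continuous_blowUp (ε : ℝ) : Continuous (blowUp L z ε) := by
  unfold blowUp
  have : Continuous fun p : E n × ℝ => WithLp.toLp 2 (√ε • p.1, ε * p.2) :=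
    (WithLp.prod_continuous_toLp 2 (E n) ℝ).comp (by fun_prop)
  exact continuous_const.add (L.symm.continuous.comp this)

theorem measurableEmbedding_blowUp {ε : ℝ} (hε : 0 < ε) : MeasurableEmbedding (blowUp L z ε) := by
  refine (continuous_blowUp L z ε).measurableEmbedding fun p q hpq => ?_
  have h1 : (√ε • p.1, ε * p.2) = (√ε • q.1, ε * q.2) := by
    have h2 := L.symm.injective (add_left_cancel hpq)
    exact WithLp.toLp_injective 2 h2
  have hs : √ε ≠ 0 := (Real.sqrt_pos.2 hε).ne'
  rw [Prod.mk.injEq] at h1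
  exact Prod.ext (smul_right_injective _ hs h1.1) (mul_left_cancel₀ hε.ne' h1.2)

theorem integral_comp_blowUp {ε : ℝ} (hε : 0 < ε) (f : E N → ℝ) :
    ∫ p, f (blowUp L z ε p) = (√ε ^ n * ε)⁻¹ * ∫ y, f y := by
  have hs : 0 < √ε := Real.sqrt_pos.2 hε
  rw [← (measurableEmbedding_blowUp L z hε).integral_map, map_blowUp L z hε,
    integral_smul_measure, ENNReal.toReal_ofReal (by positivity), smul_eq_mul]

end ChangeOfVariables

/-! ### The integral of a power of the solution over the touching ball -/

/-- The limit of the rescaled powers of the solutions, as a function of the blow-up coordinates. -/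
noncomputable def profile {n : ℕ} (R α c : ℝ) (κ : Fin n → ℝ) : E n × ℝ → ℝ :=
  {p : E n × ℝ | ‖p.1‖ ^ 2 < 2 * R * p.2}.indicator
    fun p => Real.exp (-(α * ((p.2 - (∑ j, κ j * (p.1 j) ^ 2) / 2) / c)))

theorem integrable_decay {n : ℕ} {a b : ℝ} (ha : 0 < a) (hb : 0 < b) (K : ℝ) :
    Integrable (fun p : E n × ℝ => K * (Real.exp (-∑ j, a * p.1 j ^ 2) *
      (Ioi (0 : ℝ)).indicator (fun t => Real.exp (-b * t)) p.2)) := by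
  refine Integrable.const_mul ?_ K
  have h2 : Integrable ((Ioi (0 : ℝ)).indicator (fun t => Real.exp (-b * t))) :=
    (integrable_indicator_iff measurableSet_Ioi).2 (exp_neg_integrableOn_Ioi 0 hb)
  exact (integrable_gaussian_euclidean (n := n) (b := fun _ => a) fun _ => ha).mul_prod h2

section Limit

variable {N n : ℕ} {M : SymMat N → ℝ} {θ C R : ℝ} {Ω : Set (E N)} {u : ℝ → E N → ℝ} {x z : E N}
  {κ : Fin n → ℝ} {L : E N ≃ₗᵢ[ℝ] WithLp 2 (E n × ℝ)}

theorem tendsto_indicator_blowUp (hM : IsRankOneStable θ C M) (hθ : 0 < θ) (hC : 0 ≤ C)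
    (hu : ∀ ε > 0, IsSolution M ε Ω (u ε)) (hF : IsTouchingFrame Ω x z R κ L) {α : ℝ} (hα : 0 < α)
    (p : E n × ℝ) :
    Tendsto (fun ε : ℝ => (Metric.ball x R).indicator (fun y => u ε y ^ α) (blowUp L z ε p))
      (𝓝[>] 0) (𝓝 (profile R α (√θ) κ p)) := by
  by_cases hp : ‖p.1‖ ^ 2 < 2 * R * p.2
  · rw [profile, indicator_of_mem (by exact hp)]
    have h1 := (tendsto_solution_blowUp hM hθ hC hu hF p hp).rpow_const (p := α) (Or.inr hα.le)
    rw [← Real.exp_mul] at h1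
    have h2 : Tendsto (fun ε : ℝ => ‖p.1‖ ^ 2 + ε * p.2 ^ 2) (𝓝[>] 0) (𝓝 (‖p.1‖ ^ 2)) := by
      have h : Continuous (fun ε : ℝ => ‖p.1‖ ^ 2 + ε * p.2 ^ 2) := by fun_prop
      simpa using (h.tendsto 0).mono_left nhdsWithin_le_nhds
    have h3 : Real.exp (-(α * ((p.2 - (∑ j, κ j * (p.1 j) ^ 2) / 2) / √θ))) =
        Real.exp (-((p.2 - (∑ j, κ j * (p.1 j) ^ 2) / 2) / √θ) * α) := by
      congr 1
      ring
    rw [h3]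
    refine h1.congr' ?_
    filter_upwards [h2.eventually (gt_mem_nhds hp), eventually_mem_nhdsWithin] with ε h4 hε
    rw [indicator_of_mem ((hF.blowUp_mem_ball_iff hε p).2 h4)]
  · rw [profile, indicator_of_notMem (by exact hp)]
    refine tendsto_const_nhds.congr' ?_
    filter_upwards [eventually_mem_nhdsWithin] with ε hε
    rw [indicator_of_notMem]
    rw [hF.blowUp_mem_ball_iff hε p]
    have : 0 ≤ ε * p.2 ^ 2 := mul_nonneg (le_of_lt hε) (sq_nonneg _)
    intro h
    exact hp (by linarith)

/-- A dominating function. Inside the ball `|v|² < 2 R t`, so that decay in `t` implies Gaussian decay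
in `v`. -/
theorem exists_integrable_bound (hM : IsRankOneStable θ C M) (hθ : 0 < θ) (hC : 0 ≤ C)
    (hu : ∀ ε > 0, IsSolution M ε Ω (u ε)) (hF : IsTouchingFrame Ω x z R κ L) {α : ℝ} (hα : 0 < α) :
    ∃ G : E n × ℝ → ℝ, Integrable G ∧ ∀ᶠ ε : ℝ in 𝓝[>] 0, ∀ p,
      ‖(Metric.ball x R).indicator (fun y => u ε y ^ α) (blowUp L z ε p)‖ ≤ G p := by
  have hR := hF.pos
  obtain ⟨k, hk, hdecay⟩ := exists_exp_decay hM hθ hC hu hF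
  refine ⟨_, integrable_decay (n := n) (a := k * α / (4 * R)) (b := k * α / 2) (by positivity)
    (by positivity) (2 ^ α), ?_⟩
  filter_upwards [hdecay, eventually_mem_nhdsWithin] with ε h1 hε p
  have hε' : (0 : ℝ) < ε := hε
  by_cases hp : blowUp L z ε p ∈ Metric.ball x R
  · rw [indicator_of_mem hp]
    have h2 := (hF.blowUp_mem_ball_iff hε p).1 hp
    have h3 : (L (blowUp L z ε p - z)).snd = ε * p.2 := by simp [blowUp]
    have h4 := h1 _ hp
    rw [h3] at h4
    have h5 : k / ε * (ε * p.2) = k * p.2 := by field_simp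
    rw [h5] at h4
    have h6 : 0 ≤ u ε (blowUp L z ε p) :=
      (hu ε hε).nonneg hM hC hF.isOpen (subset_closure (hF.ball_subset hp))
    have h7 : ‖p.1‖ ^ 2 < 2 * R * p.2 := by
      have : 0 ≤ ε * p.2 ^ 2 := mul_nonneg hε'.le (sq_nonneg _)
      linarith
    have h8 : 0 < p.2 := by
      by_contra h
      nlinarith [sq_nonneg ‖p.1‖]
    rw [Real.norm_eq_abs, abs_of_nonneg (Real.rpow_nonneg h6 α),
      indicator_of_mem (show p.2 ∈ Ioi 0 from h8), ← Real.exp_add]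
    refine (Real.rpow_le_rpow h6 h4 hα.le).trans ?_
    rw [Real.mul_rpow (by norm_num) (Real.exp_pos _).le, ← Real.exp_mul]
    refine mul_le_mul_of_nonneg_left (Real.exp_le_exp.2 ?_) (by positivity)
    rw [← Finset.mul_sum, ← EuclideanSpace.real_norm_sq_eq]
    have h9 : k * α / (4 * R) * ‖p.1‖ ^ 2 ≤ k * α / (4 * R) * (2 * R * p.2) := by gcongr
    have h10 : k * α / (4 * R) * (2 * R * p.2) = k * α / 2 * p.2 := by
      field_simp
      ring
    linarith
  · rw [indicator_of_notMem hp, norm_zero]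
    have : 0 ≤ (Ioi (0 : ℝ)).indicator (fun t => Real.exp (-(k * α / 2) * t)) p.2 :=
      indicator_nonneg (fun _ _ => (Real.exp_pos _).le) _
    positivity

theorem isOpen_profile_domain (n : ℕ) (R : ℝ) :
    IsOpen {p : E n × ℝ | ‖p.1‖ ^ 2 < 2 * R * p.2} :=
  isOpen_lt (by fun_prop) (by fun_prop)

theorem integrable_profile (hM : IsRankOneStable θ C M) (hθ : 0 < θ) (hC : 0 ≤ C)
    (hu : ∀ ε > 0, IsSolution M ε Ω (u ε)) (hF : IsTouchingFrame Ω x z R κ L) {α : ℝ}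
    (hα : 0 < α) : Integrable (profile R α (√θ) κ) := by
  obtain ⟨G, hG, hle⟩ := exists_integrable_bound hM hθ hC hu hF hα
  refine hG.mono' ?_ (ae_of_all _ fun p => ?_)
  · rw [profile, aestronglyMeasurable_indicator_iff (isOpen_profile_domain n R).measurableSet]
    have h : Continuous fun p : E n × ℝ =>
        Real.exp (-(α * ((p.2 - (∑ j, κ j * (p.1 j) ^ 2) / 2) / √θ))) := by fun_prop
    exact h.aestronglyMeasurable
  · exact le_of_tendsto (tendsto_indicator_blowUp hM hθ hC hu hF hα p).norm
      (hle.mono fun ε h => h p)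

theorem tendsto_integral_rpow (hM : IsRankOneStable θ C M) (hθ : 0 < θ) (hC : 0 ≤ C)
    (hu : ∀ ε > 0, IsSolution M ε Ω (u ε)) (hF : IsTouchingFrame Ω x z R κ L) {α : ℝ}
    (hα : 0 < α) :
    Tendsto (fun ε : ℝ => (√ε ^ n * ε)⁻¹ * ∫ y in Metric.ball x R, u ε y ^ α) (𝓝[>] 0)
      (𝓝 (∫ p, profile R α (√θ) κ p)) := by
  obtain ⟨G, hG, hle⟩ := exists_integrable_bound hM hθ hC hu hF hα
  have h1 : Tendsto (fun ε : ℝ => ∫ p, (Metric.ball x R).indicator (fun y => u ε y ^ α)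
      (blowUp L z ε p)) (𝓝[>] 0) (𝓝 (∫ p, profile R α (√θ) κ p)) := by
    refine tendsto_integral_filter_of_dominated_convergence G ?_
      (hle.mono fun ε h => ae_of_all _ h) hG
      (ae_of_all _ fun p => tendsto_indicator_blowUp hM hθ hC hu hF hα p)
    filter_upwards [eventually_mem_nhdsWithin] with ε hε
    have h2 : (fun p : E n × ℝ => (Metric.ball x R).indicator (fun y => u ε y ^ α)
        (blowUp L z ε p)) = (blowUp L z ε ⁻¹' Metric.ball x R).indicator
          (fun p => u ε (blowUp L z ε p) ^ α) := rfl
    have hS : IsOpen (blowUp L z ε ⁻¹' Metric.ball x R) :=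
      Metric.isOpen_ball.preimage (continuous_blowUp L z ε)
    rw [h2, aestronglyMeasurable_indicator_iff hS.measurableSet]
    refine ContinuousOn.aestronglyMeasurable (ContinuousOn.rpow_const ?_
      fun p _ => Or.inr hα.le) hS.measurableSet
    exact ((hu ε hε).continuousOn.mono (hF.ball_subset.trans subset_closure)).comp
      (continuous_blowUp L z ε).continuousOn fun p hp => hp
  refine h1.congr' ?_
  filter_upwards [eventually_mem_nhdsWithin] with ε hε
  rw [integral_comp_blowUp L z hε, integral_indicator Metric.isOpen_ball.measurableSet]

end Limit

theorem integral_exp_neg_mul_Ioi {b : ℝ} (hb : 0 < b) (s : ℝ) :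
    ∫ t in Ioi s, Real.exp (-(b * t)) = b⁻¹ * Real.exp (-(b * s)) := by
  have h := integral_comp_mul_left_Ioi (fun t => Real.exp (-t)) s hb
  rw [h, integral_exp_neg_Ioi, smul_eq_mul]

theorem integral_profile {n : ℕ} {R α c : ℝ} {κ : Fin n → ℝ} (hR : 0 < R) (hα : 0 < α)
    (hc : 0 < c) (hint : Integrable (profile R α c κ)) :
    ∫ p, profile R α c κ p = c / α * ∏ j, √(Real.pi / (α / (2 * c) * (1 / R - κ j))) := by
  rw [Measure.volume_eq_prod, integral_prod _ (by rwa [← Measure.volume_eq_prod])]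
  have h1 : ∀ v : E n, ∫ t, profile R α c κ (v, t) =
      c / α * Real.exp (-∑ j, α / (2 * c) * (1 / R - κ j) * v j ^ 2) := by
    intro v
    have h2 : (fun t => profile R α c κ (v, t)) = (Ioi (‖v‖ ^ 2 / (2 * R))).indicator
        (fun t => Real.exp (α / c * ((∑ j, κ j * (v j) ^ 2) / 2)) * Real.exp (-(α / c * t))) := by
      ext t
      by_cases ht : ‖v‖ ^ 2 < 2 * R * t
      · rw [profile, indicator_of_mem (by exact ht), indicator_of_mem (by
          show _ < t
          rw [div_lt_iff₀ (by positivity)]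
          linarith), ← Real.exp_add]
        congr 1
        ring
      · rw [profile, indicator_of_notMem (by exact ht), indicator_of_notMem]
        show ¬ _ < t
        rw [div_lt_iff₀ (by positivity)]
        intro h
        exact ht (by linarith)
    rw [h2, integral_indicator measurableSet_Ioi, integral_const_mul,
      integral_exp_neg_mul_Ioi (by positivity), mul_left_comm, ← Real.exp_add, inv_div]
    congr 2
    rw [EuclideanSpace.real_norm_sq_eq, Finset.sum_div, Finset.sum_div, Finset.mul_sum,
      Finset.mul_sum, ← Finset.sum_neg_distrib, ← Finset.sum_neg_distrib, ← Finset.sum_add_distrib]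
    refine Finset.sum_congr rfl fun j _ => ?_
    field_simp
    ring
  simp only [h1]
  rw [integral_const_mul, integral_gaussian_euclidean]

/-! ### The signed power -/

/-- The signed power `sgn(t) |t|^α`. -/
noncomputable def signedPow (α t : ℝ) : ℝ := (max t 0) ^ α - (max (-t) 0) ^ α

section SignedPow

variable {α : ℝ}

theorem signedPow_of_nonneg (hα : 0 < α) {t : ℝ} (ht : 0 ≤ t) : signedPow α t = t ^ α := by
  rw [signedPow, max_eq_left ht, max_eq_right (by linarith), Real.zero_rpow hα.ne', sub_zero]

theorem signedPow_neg (t : ℝ) : signedPow α (-t) = -signedPow α t := by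
  simp [signedPow]

theorem continuous_signedPow (hα : 0 < α) : Continuous (signedPow α) := by
  unfold signedPow
  exact ((continuous_id.max continuous_const).rpow_const fun _ => Or.inr hα.le).sub
    ((continuous_neg.max continuous_const).rpow_const fun _ => Or.inr hα.le)

theorem monotone_signedPow (hα : 0 < α) : Monotone (signedPow α) := by
  intro s t hst
  have h1 : max s 0 ^ α ≤ max t 0 ^ α :=
    Real.rpow_le_rpow (le_max_right _ _) (max_le_max hst le_rfl) hα.le
  have h2 : max (-t) 0 ^ α ≤ max (-s) 0 ^ α :=
    Real.rpow_le_rpow (le_max_right _ _) (max_le_max (neg_le_neg hst) le_rfl) hα.le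
  unfold signedPow
  linarith

theorem abs_signedPow (hα : 0 < α) (t : ℝ) : |signedPow α t| = |t| ^ α := by
  rcases le_total 0 t with ht | ht
  · rw [signedPow_of_nonneg hα ht, abs_of_nonneg ht, abs_of_nonneg (Real.rpow_nonneg ht _)]
  · rw [← neg_neg t, signedPow_neg, abs_neg, abs_neg,
      signedPow_of_nonneg hα (by linarith : 0 ≤ -t), abs_of_nonneg (by linarith : 0 ≤ -t),
      abs_of_nonneg (Real.rpow_nonneg (by linarith) _)]

theorem signedPow_mul (hα : 0 < α) {m : ℝ} (hm : 0 ≤ m) (t : ℝ) :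
    signedPow α (m * t) = m ^ α * signedPow α t := by
  rcases le_total 0 t with ht | ht
  · rw [signedPow_of_nonneg hα ht, signedPow_of_nonneg hα (mul_nonneg hm ht), Real.mul_rpow hm ht]
  · have ht' : 0 ≤ -t := by linarith
    rw [← neg_neg t, mul_neg, signedPow_neg, signedPow_neg, signedPow_of_nonneg hα ht',
      signedPow_of_nonneg hα (mul_nonneg hm ht'), Real.mul_rpow hm ht', mul_neg]

/-- Strict convexity of `t ↦ |t|^q`: the graph lies above its tangents. -/
theorem abs_rpow_add_lt {q s t : ℝ} (hq : 1 < q) (hst : t ≠ s) :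
    |s| ^ q + q * signedPow (q - 1) s * (t - s) < |t| ^ q := by
  have hq1 : 0 < q - 1 := by linarith
  have pos : ∀ s t : ℝ, 0 < s → t ≠ s → |s| ^ q + q * signedPow (q - 1) s * (t - s) < |t| ^ q := by
    intro s t hs hst
    have h1 : s ^ q = s ^ (q - 1) * s := by
      rw [← Real.rpow_add_one hs.ne']
      congr 1
      ring
    have h2 : 0 < s ^ (q - 1) := Real.rpow_pos_of_pos hs _
    rw [signedPow_of_nonneg hq1 hs.le, abs_of_pos hs]
    rcases le_or_gt t 0 with ht | ht
    · have h3 : 0 ≤ |t| ^ q := Real.rpow_nonneg (abs_nonneg _) _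
      have h4 : 0 < s ^ (q - 1) * s * (q - 1) := by positivity
      have h5 : s ^ (q - 1) * q * t ≤ 0 := mul_nonpos_of_nonneg_of_nonpos (by positivity) ht
      rw [h1]
      linarith
    · have h3 := one_add_mul_self_lt_rpow_one_add (s := t / s - 1) (p := q)
        (by have := div_pos ht hs; linarith) (by
          rw [sub_ne_zero, Ne, div_eq_one_iff_eq hs.ne']
          exact hst) hq
      rw [add_sub_cancel, Real.div_rpow ht.le hs.le, lt_div_iff₀ (Real.rpow_pos_of_pos hs _)] at h3
      rw [abs_of_pos ht]
      refine lt_of_eq_of_lt ?_ h3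
      rw [h1]
      field_simp
  rcases lt_trichotomy s 0 with hs | hs | hs
  · have h := pos (-s) (-t) (by linarith) (fun h => hst (by linarith))
    rw [signedPow_neg, abs_neg, abs_neg] at h
    linarith
  · subst hs
    have h : 0 < |t| ^ q := Real.rpow_pos_of_pos (abs_pos.2 hst) _
    rw [signedPow_of_nonneg hq1 le_rfl, Real.zero_rpow hq1.ne', abs_zero,
      Real.zero_rpow (by linarith)]
    linarith
  · exact pos s t hs hst

/-- Unless `f` and `m` are comparable, the signed power of `m - f` is nearly `m^α - f^α`. -/
theorem exists_signedPow_sub_bound (hα : 0 < α) {δ : ℝ} (hδ : 0 < δ) :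
    ∃ c > 0, ∃ K ≥ 0, ∀ m f : ℝ, 0 ≤ m → 0 ≤ f →
      |signedPow α (m - f) - m ^ α + f ^ α| ≤
        δ * m ^ α + δ * f ^ α + K * (m ^ α * if c * m < f then 1 else 0) := by
  have hcont : Continuous fun r : ℝ => signedPow α (1 - r) - 1 + |r| ^ α :=
    (((continuous_signedPow hα).comp (continuous_const.sub continuous_id)).sub
      continuous_const).add (continuous_abs.rpow_const fun _ => Or.inr hα.le)
  have h0 : signedPow α (1 - 0) - 1 + |(0 : ℝ)| ^ α = 0 := by
    rw [sub_zero, signedPow_of_nonneg hα zero_le_one, Real.one_rpow, abs_zero,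
      Real.zero_rpow hα.ne']
    norm_num
  have hev : ∀ᶠ r : ℝ in 𝓝[>] 0, |signedPow α (1 - r) - 1 + |r| ^ α| < δ := by
    have := (hcont.tendsto 0).mono_left (nhdsWithin_le_nhds (s := Ioi 0))
    rw [h0] at this
    have h2 := this.abs
    rw [abs_zero] at h2
    exact h2.eventually (gt_mem_nhds hδ)
  obtain ⟨b, hb0, hb⟩ := mem_nhdsGT_iff_exists_Ioo_subset.1 hev
  have hb0' : (0 : ℝ) < b := hb0
  set c := min (b / 2) 1 with hc
  have hc0 : 0 < c := lt_min (by positivity) one_pos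
  have hcb : c < b := (min_le_left _ _).trans_lt (by linarith)
  have hc1 : c ≤ 1 := min_le_right _ _
  -- The expression is antisymmetric in `m` and `f`; this is the case in which `f` is much smaller than `m`
  have hsmall : ∀ m f : ℝ, 0 ≤ m → 0 ≤ f → f ≤ c * m →
      |signedPow α (m - f) - m ^ α + f ^ α| ≤ δ * m ^ α := by
    intro m f hm hf hfm
    rcases hm.eq_or_lt with rfl | hm
    · have : f = 0 := le_antisymm (by simpa using hfm) hf
      subst this
      rw [sub_zero, signedPow_of_nonneg hα le_rfl, Real.zero_rpow hα.ne']
      simp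
    · have h1 : m - f = m * (1 - f / m) := by field_simp
      have h2 : f ^ α = m ^ α * |f / m| ^ α := by
        rw [abs_of_nonneg (by positivity), ← Real.mul_rpow hm.le (by positivity)]
        congr 1
        field_simp
      have h3 : |signedPow α (1 - f / m) - 1 + |f / m| ^ α| ≤ δ := by
        rcases hf.eq_or_lt with rfl | hf
        · rw [zero_div, h0, abs_zero]
          exact hδ.le
        · refine (hb ⟨by positivity, ?_⟩ : _ < δ).le
          rw [div_lt_iff₀ hm]
          exact hfm.trans_lt (mul_lt_mul_of_pos_right hcb hm)
      have h4 : signedPow α (m - f) - m ^ α + f ^ α =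
          m ^ α * (signedPow α (1 - f / m) - 1 + |f / m| ^ α) := by
        rw [h1, signedPow_mul hα hm.le, h2]
        ring
      rw [h4, abs_mul, abs_of_nonneg (Real.rpow_nonneg hm.le _), mul_comm]
      exact mul_le_mul_of_nonneg_right h3 (Real.rpow_nonneg hm.le _)
  refine ⟨c, hc0, 1 + 2 * (1 / c) ^ α, by positivity, fun m f hm hf => ?_⟩
  have hmα := Real.rpow_nonneg hm α
  have hfα := Real.rpow_nonneg hf α
  by_cases h1 : c * m < f
  · rw [if_pos h1, mul_one]
    by_cases h2 : m ≤ c * f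
    · have h3 := hsmall f m hf hm h2
      have h4 : signedPow α (m - f) - m ^ α + f ^ α =
          -(signedPow α (f - m) - f ^ α + m ^ α) := by
        rw [← neg_sub f m, signedPow_neg]
        ring
      rw [h4, abs_neg]
      have : 0 ≤ (1 + 2 * (1 / c) ^ α) * m ^ α := by positivity
      have : 0 ≤ δ * m ^ α := by positivity
      linarith
    · push Not at h2
      have h3 : f ≤ 1 / c * m := by
        rw [one_div, inv_mul_eq_div, le_div_iff₀ hc0]
        linarith
      have h4 : f ^ α ≤ (1 / c) ^ α * m ^ α := by
        rw [← Real.mul_rpow (by positivity) hm]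
        exact Real.rpow_le_rpow hf h3 hα.le
      have h5 : |signedPow α (m - f)| ≤ (1 / c) ^ α * m ^ α := by
        rw [abs_signedPow hα, ← Real.mul_rpow (by positivity) hm]
        refine Real.rpow_le_rpow (abs_nonneg _) ?_ hα.le
        have h6 : m ≤ 1 / c * m := le_mul_of_one_le_left hm ((one_le_div hc0).2 hc1)
        rw [abs_le]
        constructor <;> linarith
      have h7 : |signedPow α (m - f) - m ^ α + f ^ α| ≤
          |signedPow α (m - f)| + m ^ α + f ^ α := by
        refine (abs_add_le _ _).trans ?_
        rw [abs_of_nonneg hfα]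
        have := abs_sub (signedPow α (m - f)) (m ^ α)
        rw [abs_of_nonneg hmα] at this
        linarith
      have : 0 ≤ δ * m ^ α := by positivity
      have : 0 ≤ δ * f ^ α := by positivity
      linarith
  · rw [if_neg h1]
    have h3 := hsmall m f hm hf (not_lt.1 h1)
    have : 0 ≤ δ * f ^ α := by positivity
    linarith

end SignedPow

/-! ### The `q`-mean as the zero of an integral -/

section Mean

variable {X : Type*} [MeasurableSpace X] {μ : Measure X} [IsFiniteMeasure μ] {f : X → ℝ} {α : ℝ}

theorem integrable_comp_of_mem_Icc (hf : AEStronglyMeasurable f μ) (h01 : ∀ᵐ y ∂μ, f y ∈ Icc 0 1)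
    {g : ℝ → ℝ} (hg : Continuous g) : Integrable (fun y => g (f y)) μ := by
  obtain ⟨K, hK⟩ := (isCompact_Icc (a := (0 : ℝ)) (b := 1)).exists_bound_of_continuousOn
    hg.continuousOn
  exact Integrable.of_bound (hg.comp_aestronglyMeasurable hf) K (h01.mono fun y hy => hK _ hy)

theorem integrable_signedPow_sub (hα : 0 < α) (hf : AEStronglyMeasurable f μ)
    (h01 : ∀ᵐ y ∂μ, f y ∈ Icc 0 1) (m : ℝ) : Integrable (fun y => signedPow α (m - f y)) μ :=
  integrable_comp_of_mem_Icc hf h01 (g := fun t => signedPow α (m - t))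
    ((continuous_signedPow hα).comp (continuous_const.sub continuous_id))

theorem exists_integral_signedPow_eq_zero (hα : 0 < α) (hf : AEStronglyMeasurable f μ)
    (h01 : ∀ᵐ y ∂μ, f y ∈ Icc 0 1) :
    ∃ m ∈ Icc (0 : ℝ) 1, ∫ y, signedPow α (m - f y) ∂μ = 0 := by
  have hcont : ContinuousOn (fun m => ∫ y, signedPow α (m - f y) ∂μ) (Icc 0 1) := by
    refine continuousOn_of_dominated (bound := fun _ => 1)
      (fun m _ => (integrable_signedPow_sub hα hf h01 m).aestronglyMeasurable) (fun m hm => ?_)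
      (integrable_const _) (ae_of_all _ fun y => ?_)
    · filter_upwards [h01] with y hy
      rw [Real.norm_eq_abs, abs_signedPow hα]
      refine Real.rpow_le_one (abs_nonneg _) ?_ hα.le
      rw [abs_le]
      constructor <;> linarith [hm.1, hm.2, hy.1, hy.2]
    · exact ((continuous_signedPow hα).comp (continuous_id.sub continuous_const)).continuousOn
  have h0 : ∫ y, signedPow α (0 - f y) ∂μ ≤ 0 := by
    refine integral_nonpos_of_ae (h01.mono fun y hy => ?_)
    have := monotone_signedPow hα (by linarith [hy.1] : 0 - f y ≤ 0)
    rwa [signedPow_of_nonneg hα le_rfl, Real.zero_rpow hα.ne'] at this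
  have h1 : 0 ≤ ∫ y, signedPow α (1 - f y) ∂μ := by
    refine integral_nonneg_of_ae (h01.mono fun y hy => ?_)
    have := monotone_signedPow hα (by linarith [hy.2] : 0 ≤ 1 - f y)
    rwa [signedPow_of_nonneg hα le_rfl, Real.zero_rpow hα.ne'] at this
  obtain ⟨m, hm, hm0⟩ := intermediate_value_Icc zero_le_one hcont ⟨h0, h1⟩
  exact ⟨m, hm, hm0⟩

/-- A zero of the derivative of `c ↦ ‖f - c‖_q^q` is its unique minimum point. -/
theorem eLpNorm_sub_lt_of_integral_eq_zero (hμ : μ ≠ 0) {q : ℝ} (hq : 1 < q)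
    (hf : AEStronglyMeasurable f μ) (h01 : ∀ᵐ y ∂μ, f y ∈ Icc 0 1) {m c : ℝ}
    (hm : ∫ y, signedPow (q - 1) (m - f y) ∂μ = 0) (hc : c ≠ m) :
    eLpNorm (fun y => f y - m) (ENNReal.ofReal q) μ <
      eLpNorm (fun y => f y - c) (ENNReal.ofReal q) μ := by
  have hq0 : 0 < q := by linarith
  have hint : ∀ a : ℝ, Integrable (fun y => |f y - a| ^ q) μ := fun a =>
    integrable_comp_of_mem_Icc hf h01 (g := fun t => |t - a| ^ q)
      ((continuous_id.sub continuous_const).abs.rpow_const fun _ => Or.inr hq0.le)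
  have hnorm : ∀ a : ℝ, eLpNorm (fun y => f y - a) (ENNReal.ofReal q) μ =
      ENNReal.ofReal ((∫ y, |f y - a| ^ q ∂μ) ^ q⁻¹) := by
    intro a
    have hmem : MemLp (fun y => f y - a) (ENNReal.ofReal q) μ := by
      refine MemLp.of_bound (hf.sub aestronglyMeasurable_const) (1 + |a|) (h01.mono fun y hy => ?_)
      refine (norm_sub_le _ _).trans ?_
      rw [Real.norm_eq_abs, Real.norm_eq_abs, abs_of_nonneg hy.1]
      linarith [hy.2]
    rw [hmem.eLpNorm_eq_integral_rpow_norm (by simpa using hq0) ENNReal.ofReal_ne_top,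
      ENNReal.toReal_ofReal hq0.le]
    rfl
  have hpos : 0 < ∫ y, (|f y - c| ^ q - |f y - m| ^ q -
      q * (c - m) * signedPow (q - 1) (m - f y)) ∂μ := by
    have hi := ((hint c).sub (hint m)).sub
      ((integrable_signedPow_sub (by linarith : 0 < q - 1) hf h01 m).const_mul (q * (c - m)))
    have hp : ∀ y, 0 < |f y - c| ^ q - |f y - m| ^ q -
        q * (c - m) * signedPow (q - 1) (m - f y) := by
      intro y
      have h := abs_rpow_add_lt (s := f y - m) (t := f y - c) hq (fun h => hc (by linarith))
      rw [← neg_sub (f y) m, signedPow_neg]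
      linarith
    rw [integral_pos_iff_support_of_nonneg (fun y => (hp y).le) hi]
    have : Function.support (fun y => |f y - c| ^ q - |f y - m| ^ q -
        q * (c - m) * signedPow (q - 1) (m - f y)) = univ :=
      eq_univ_of_forall fun y => (hp y).ne'
    rw [this]
    exact Measure.measure_univ_pos.2 hμ
  have hsub : Integrable (fun y => |f y - c| ^ q - |f y - m| ^ q) μ := (hint c).sub (hint m)
  rw [integral_sub hsub
    ((integrable_signedPow_sub (by linarith : 0 < q - 1) hf h01 m).const_mul _),
    integral_sub (hint c) (hint m), integral_const_mul, hm, mul_zero, sub_zero] at hpos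
  have h0 : 0 ≤ ∫ y, |f y - m| ^ q ∂μ :=
    integral_nonneg fun y => Real.rpow_nonneg (abs_nonneg _) _
  rw [hnorm, hnorm, ENNReal.ofReal_lt_ofReal_iff (Real.rpow_pos_of_pos (by linarith) _)]
  exact Real.rpow_lt_rpow h0 (by linarith) (by positivity)

end Mean

/-- Asymptotics of the zeros of `m ↦ ∫ sgn(m - f) |m - f|^α` for functions `f ≥ 0` whose powers have
integrals of the order of `w → 0` and which are pointwise much smaller than `w^{1/α}`: the part of
the integral on which `f` dominates is `-∫ f^α`, and on the rest the integrand is `m^α`. -/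
theorem tendsto_zero_div_rpow {X ι : Type*} [MeasurableSpace X] {μ : Measure X} [IsFiniteMeasure μ]
    (hμ : μ ≠ 0) {l : Filter ι} [l.IsCountablyGenerated] {f : ι → X → ℝ} {w m : ι → ℝ} {α I : ℝ}
    (hα : 0 < α) (hf : ∀ᶠ i in l, AEStronglyMeasurable (f i) μ)
    (h01 : ∀ᶠ i in l, ∀ᵐ y ∂μ, f i y ∈ Icc 0 1) (hw : ∀ᶠ i in l, 0 < w i)
    (hI : Tendsto (fun i => (w i)⁻¹ * ∫ y, f i y ^ α ∂μ) l (𝓝 I)) (hI0 : 0 ≤ I)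
    (hsmall : ∀ c > 0, ∀ᵐ y ∂μ, ∀ᶠ i in l, f i y ≤ c * w i ^ (1 / α))
    (hm0 : ∀ᶠ i in l, 0 ≤ m i) (hm : ∀ᶠ i in l, ∫ y, signedPow α (m i - f i y) ∂μ = 0) :
    Tendsto (fun i => m i / w i ^ (1 / α)) l (𝓝 ((I / μ.real univ) ^ (1 / α))) := by
  set V := μ.real univ with hV
  have hV0 : 0 < V := by
    rw [hV, measureReal_def]
    exact ENNReal.toReal_pos (Measure.measure_univ_pos.2 hμ).ne' (measure_ne_top _ _)
  -- the limit of the rescaled integral at multiples of `w^{1/α}`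
  have key : ∀ τ : ℝ, 0 ≤ τ →
      Tendsto (fun i => (w i)⁻¹ * ∫ y, signedPow α (τ * w i ^ (1 / α) - f i y) ∂μ) l
        (𝓝 (τ ^ α * V - I)) := by
    intro τ hτ
    have hmeas : ∀ c > 0, Tendsto (fun i => ∫ y, (if c * (τ * w i ^ (1 / α)) < f i y
        then (1 : ℝ) else 0) ∂μ) l (𝓝 0) ∨ τ = 0 := by
      intro c hc
      rcases hτ.eq_or_lt with h | hτ
      · exact Or.inr h.symm
      left
      have h := tendsto_integral_filter_of_dominated_convergence (μ := μ) (l := l)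
        (F := fun i y => if c * (τ * w i ^ (1 / α)) < f i y then (1 : ℝ) else 0)
        (f := fun _ => 0) (fun _ => 1) ?_ ?_ (integrable_const _) ?_
      · simpa using h
      · filter_upwards [hf] with i hi
        have hs : NullMeasurableSet {y | c * (τ * w i ^ (1 / α)) < f i y} μ :=
          nullMeasurableSet_lt aemeasurable_const hi.aemeasurable
        refine ((aemeasurable_const (b := (1 : ℝ))).indicator₀ hs).aestronglyMeasurable.congr
          (ae_of_all _ fun y => ?_)
        simp [indicator_apply]
      · refine Eventually.of_forall fun i => ae_of_all _ fun y => ?_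
        split_ifs <;> simp
      · filter_upwards [hsmall (c * τ) (by positivity)] with y hy
        refine tendsto_const_nhds.congr' ?_
        filter_upwards [hy] with i hi
        rw [if_neg]
        rw [not_lt]
        linarith
    have herr : Tendsto (fun i => (w i)⁻¹ * ∫ y, (signedPow α (τ * w i ^ (1 / α) - f i y) -
        (τ * w i ^ (1 / α)) ^ α + f i y ^ α) ∂μ) l (𝓝 0) := by
      rw [Metric.tendsto_nhds]
      intro b hb
      obtain ⟨δ, hδ, hδb⟩ : ∃ δ > 0, δ * (τ ^ α * V) + δ * I < b := by
        have h : Tendsto (fun δ : ℝ => δ * (τ ^ α * V) + δ * I) (𝓝[>] 0) (𝓝 0) := by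
          have h : Continuous (fun δ : ℝ => δ * (τ ^ α * V) + δ * I) := by fun_prop
          simpa using (h.tendsto 0).mono_left nhdsWithin_le_nhds
        obtain ⟨δ, h1, h2⟩ := ((h.eventually (gt_mem_nhds hb)).and eventually_mem_nhdsWithin).exists
        exact ⟨δ, h2, h1⟩
      obtain ⟨c, hc, K, hK, hbound⟩ := exists_signedPow_sub_bound hα hδ
      have hlim : Tendsto (fun i => δ * (τ ^ α * V) + δ * ((w i)⁻¹ * ∫ y, f i y ^ α ∂μ) +
          K * (τ ^ α * ∫ y, (if c * (τ * w i ^ (1 / α)) < f i y then (1 : ℝ) else 0) ∂μ)) l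
          (𝓝 (δ * (τ ^ α * V) + δ * I + K * (τ ^ α * 0))) := by
        refine (tendsto_const_nhds.add (hI.const_mul δ)).add (Tendsto.const_mul K ?_)
        rcases hmeas c hc with h | h
        · exact h.const_mul _
        · simp only [h, Real.zero_rpow hα.ne', zero_mul]
          exact tendsto_const_nhds
      rw [mul_zero, mul_zero, add_zero] at hlim
      filter_upwards [hlim.eventually (gt_mem_nhds hδb), hf, h01, hw] with i h1 h2 h3 h4
      rw [dist_zero_right]
      refine lt_of_le_of_lt ?_ h1
      have hpow : (τ * w i ^ (1 / α)) ^ α = τ ^ α * w i := by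
        rw [Real.mul_rpow hτ (Real.rpow_nonneg h4.le _), ← Real.rpow_mul h4.le,
          one_div_mul_cancel hα.ne', Real.rpow_one]
      have hm' : 0 ≤ τ * w i ^ (1 / α) := mul_nonneg hτ (Real.rpow_nonneg h4.le _)
      have hind : Integrable (fun y => if c * (τ * w i ^ (1 / α)) < f i y then (1 : ℝ) else 0)
          μ := by
        have hs : NullMeasurableSet {y | c * (τ * w i ^ (1 / α)) < f i y} μ :=
          nullMeasurableSet_lt aemeasurable_const h2.aemeasurable
        refine ((integrable_const (1 : ℝ)).indicator₀ hs).congr (ae_of_all _ fun y => ?_)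
        simp [indicator_apply]
      have hfα : Integrable (fun y => f i y ^ α) μ :=
        integrable_comp_of_mem_Icc h2 h3 (g := fun t => t ^ α)
          (continuous_id.rpow_const fun _ => Or.inr hα.le)
      have h5 : ‖∫ y, (signedPow α (τ * w i ^ (1 / α) - f i y) -
          (τ * w i ^ (1 / α)) ^ α + f i y ^ α) ∂μ‖ ≤
          ∫ y, (δ * (τ * w i ^ (1 / α)) ^ α + δ * f i y ^ α + K * ((τ * w i ^ (1 / α)) ^ α *
            if c * (τ * w i ^ (1 / α)) < f i y then 1 else 0)) ∂μ := by
        refine norm_integral_le_of_norm_le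
          (((integrable_const _).add (hfα.const_mul δ)).add ((hind.const_mul _).const_mul K))
          (h3.mono fun y hy => ?_)
        exact hbound _ _ hm' hy.1
      have hadd : Integrable (fun y => δ * (τ * w i ^ (1 / α)) ^ α + δ * f i y ^ α) μ :=
        (integrable_const _).add (hfα.const_mul δ)
      rw [integral_add hadd ((hind.const_mul _).const_mul K), integral_add (integrable_const _) (hfα.const_mul δ),
        integral_const, integral_const_mul, integral_const_mul, integral_const_mul, hpow,
        smul_eq_mul] at h5
      rw [hpow, norm_mul, norm_inv, Real.norm_of_nonneg h4.le]
      refine (mul_le_mul_of_nonneg_left h5 (by positivity)).trans_eq ?_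
      field_simp
      ring
    have hsum := (herr.add (tendsto_const_nhds (x := τ ^ α * V))).sub hI
    rw [zero_add] at hsum
    refine hsum.congr' ?_
    filter_upwards [hf, h01, hw] with i h2 h3 h4
    have hpow : (τ * w i ^ (1 / α)) ^ α = τ ^ α * w i := by
      rw [Real.mul_rpow hτ (Real.rpow_nonneg h4.le _), ← Real.rpow_mul h4.le,
        one_div_mul_cancel hα.ne', Real.rpow_one]
    have hfα : Integrable (fun y => f i y ^ α) μ :=
      integrable_comp_of_mem_Icc h2 h3 (g := fun t => t ^ α)
        (continuous_id.rpow_const fun _ => Or.inr hα.le)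
    have hs := integrable_signedPow_sub hα h2 h3 (τ * w i ^ (1 / α))
    have hsub : Integrable (fun y => signedPow α (τ * w i ^ (1 / α) - f i y) -
        (τ * w i ^ (1 / α)) ^ α) μ := hs.sub (integrable_const _)
    rw [integral_add hsub hfα, integral_sub hs (integrable_const _),
      integral_const, hpow, smul_eq_mul]
    field_simp
    ring
  have hmono : ∀ᶠ i in l, ∀ a b : ℝ, a ≤ b →
      ∫ y, signedPow α (a - f i y) ∂μ ≤ ∫ y, signedPow α (b - f i y) ∂μ := by
    filter_upwards [hf, h01] with i h2 h3 a b hab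
    exact integral_mono (integrable_signedPow_sub hα h2 h3 a) (integrable_signedPow_sub hα h2 h3 b)
      fun y => monotone_signedPow hα (by linarith)
  have hroot : ((I / V) ^ (1 / α)) ^ α = I / V := by
    rw [← Real.rpow_mul (by positivity), one_div_mul_cancel hα.ne', Real.rpow_one]
  refine tendsto_order.2 ⟨fun τ hτ => ?_, fun τ hτ => ?_⟩
  · rcases lt_or_ge τ 0 with hτ0 | hτ0
    · filter_upwards [hm0, hw] with i h1 h2
      exact hτ0.trans_le (div_nonneg h1 (Real.rpow_nonneg h2.le _))
    have h1 : τ ^ α * V - I < 0 := by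
      have := Real.rpow_lt_rpow hτ0 hτ hα
      rw [hroot, lt_div_iff₀ hV0] at this
      linarith
    filter_upwards [(key τ hτ0).eventually (gt_mem_nhds h1), hw, hm, hmono] with i h2 h3 h4 h5
    rw [lt_div_iff₀ (Real.rpow_pos_of_pos h3 _)]
    by_contra h6
    have h7 := h5 _ _ (not_lt.1 h6)
    rw [h4] at h7
    have := mul_nonneg (inv_nonneg.2 h3.le) h7
    linarith
  · have hτ0 : 0 ≤ τ := (Real.rpow_nonneg (by positivity) _).trans hτ.le
    have h1 : 0 < τ ^ α * V - I := by
      have := Real.rpow_lt_rpow (Real.rpow_nonneg (by positivity) _) hτ hα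
      rw [hroot, div_lt_iff₀ hV0] at this
      linarith
    filter_upwards [(key τ hτ0).eventually (lt_mem_nhds h1), hw, hm, hmono] with i h2 h3 h4 h5
    rw [div_lt_iff₀ (Real.rpow_pos_of_pos h3 _)]
    by_contra h6
    have h7 := h5 _ _ (not_lt.1 h6)
    rw [h4] at h7
    have := mul_nonpos_of_nonneg_of_nonpos (inv_nonneg.2 h3.le) h7
    linarith

/-! ### Geometry at the touching point -/

/-- Second order Taylor expansion at a critical point. -/
theorem exists_abs_sub_quadratic_le {n : ℕ} {ζ : E n → ℝ} (hζ : ContDiff ℝ 2 ζ) {v₀ : E n}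
    (h0 : fderiv ℝ ζ v₀ = 0) {κ : Fin n → ℝ} (hκ : hessianMatrix ζ v₀ = Matrix.diagonal κ)
    {η : ℝ} (hη : 0 < η) :
    ∃ ρ > 0, ∀ v : E n, ‖v‖ ≤ ρ →
      |ζ (v₀ + v) - ζ v₀ - (∑ j, κ j * (v j) ^ 2) / 2| ≤ η * ‖v‖ ^ 2 := by
  set B := fderiv ℝ (fderiv ℝ ζ) v₀ with hB
  have hBκ : ∀ v : E n, B v v = ∑ j, κ j * (v j) ^ 2 := by
    intro v
    rw [hB, ← hessianMatrix_dotProduct, hκ]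
    simp only [dotProduct, Matrix.mulVec_diagonal]
    exact Finset.sum_congr rfl fun j _ => by ring
  have hsymm : ∀ v w, B v w = B w v := fun v w =>
    (hζ.contDiffAt.isSymmSndFDerivAt (by simp)) v w
  have hD : HasFDerivAt (fderiv ℝ ζ) B v₀ :=
    ((hζ.fderiv_right (m := 1) (by norm_num)).differentiable (by simp) v₀).hasFDerivAt
  have hlo := (hasFDerivAt_iff_isLittleO_nhds_zero.1 hD).def hη
  obtain ⟨ρ, hρ, hball⟩ := Metric.eventually_nhds_iff_ball.1 hlo
  refine ⟨ρ / 2, by positivity, fun v hv => ?_⟩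
  have hderiv : ∀ w ∈ Metric.closedBall (0 : E n) ‖v‖, HasFDerivWithinAt
      (fun w => ζ (v₀ + w) - ζ v₀ - B w w / 2) (fderiv ℝ ζ (v₀ + w) - B w)
      (Metric.closedBall 0 ‖v‖) w := by
    intro w _
    have h1 : HasFDerivAt (fun w => ζ (v₀ + w)) (fderiv ℝ ζ (v₀ + w)) w := by
      have h2 : HasFDerivAt ζ (fderiv ℝ ζ (v₀ + w)) (v₀ + w) :=
        (hζ.differentiable (by simp) _).hasFDerivAt
      simpa [Function.comp_def] using h2.comp w ((hasFDerivAt_id w).const_add v₀)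
    have h3 : HasFDerivAt (fun w => B w w) (B w + B.flip w) w := by
      refine (B.hasFDerivAt.clm_apply (hasFDerivAt_id w)).congr_fderiv ?_
      ext h
      simp
    have h4 := (h1.sub_const (ζ v₀)).sub (h3.mul_const (1 / 2))
    refine HasFDerivAt.hasFDerivWithinAt ?_
    refine (h4.congr_fderiv ?_).congr_of_eventuallyEq (Eventually.of_forall fun w => ?_)
    · ext h
      simp [hsymm h w]
      ring
    · simp [div_eq_mul_inv]
  have hbound : ∀ w ∈ Metric.closedBall (0 : E n) ‖v‖, ‖fderiv ℝ ζ (v₀ + w) - B w‖ ≤ η * ‖v‖ := by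
    intro w hw
    have hw' : ‖w‖ ≤ ‖v‖ := by simpa using hw
    have h1 := hball w (by
      rw [mem_ball_zero_iff]
      linarith)
    rw [h0, sub_zero] at h1
    exact h1.trans (mul_le_mul_of_nonneg_left hw' hη.le)
  have h := (convex_closedBall (0 : E n) ‖v‖).norm_image_sub_le_of_norm_hasFDerivWithin_le hderiv
    hbound (Metric.mem_closedBall_self (norm_nonneg v)) (y := v) (by simp)
  simp only [map_zero, add_zero, sub_self, zero_div, sub_zero] at h
  rw [← hBκ, ← Real.norm_eq_abs, sq, ← mul_assoc]
  exact h

section Touching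

variable {N : ℕ} {Ω : Set (E N)} {x z : E N} {R : ℝ} {κ : Fin (N - 1) → ℝ}

/-- The ball `B_R(x)` cannot contain a segment issued from `z` that points below the tangent
plane. -/
theorem not_eventually_mem_closedBall {T : E N ≃ᵃⁱ[ℝ] WithLp 2 (E (N - 1) × ℝ)}
    {ζ : E (N - 1) → ℝ} (hT : IsLocalC2Graph Ω z T ζ) (hz : z ∈ frontier Ω)
    (h0 : fderiv ℝ ζ (T z).fst = 0) (htouch : Metric.closedBall x R ∩ Ωᶜ = {z}) {w : E N}
    (hw : (T.linearIsometryEquiv w).snd < 0) :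
    ¬ ∀ᶠ s : ℝ in 𝓝[>] 0, z + s • w ∈ Metric.closedBall x R := by
  intro hev
  obtain ⟨hζ, r, hr, hgraph⟩ := hT
  set L := T.linearIsometryEquiv with hL
  have hTw : ∀ v : E N, T (z + v) = T z + L v := fun v => by
    have := T.map_vadd z v
    rw [vadd_eq_add, vadd_eq_add, add_comm] at this
    rw [this, add_comm]
  have hz0 : ζ (T z).fst = (T z).snd := (hgraph z (Metric.mem_ball_self hr)).2.1 hz
  have hd : HasDerivAt (fun s : ℝ => ζ ((T z).fst + s • (L w).fst)) 0 0 := by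
    have h1 : HasFDerivAt ζ (0 : E (N - 1) →L[ℝ] ℝ) ((T z).fst + (0 : ℝ) • (L w).fst) := by
      rw [zero_smul, add_zero, ← h0]
      exact (hζ.differentiable (by simp) _).hasFDerivAt
    have h2 : HasDerivAt (fun s : ℝ => (T z).fst + s • (L w).fst) (L w).fst 0 := by
      simpa using ((hasDerivAt_id (0 : ℝ)).smul_const (L w).fst).const_add (T z).fst
    simpa [Function.comp_def] using h1.comp_hasDerivAt 0 h2
  have hslope := hd.tendsto_slope_zero_right
  have hnear : ∀ᶠ s : ℝ in 𝓝[>] 0, z + s • w ∈ Metric.ball z r := by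
    have hc : Continuous fun s : ℝ => z + s • w := by fun_prop
    have := (hc.tendsto 0).mono_left (nhdsWithin_le_nhds (s := Ioi 0))
    simp only [zero_smul, add_zero] at this
    exact this.eventually (Metric.ball_mem_nhds z hr)
  have hle : (0 : ℝ) ≤ (L w).snd := by
    refine le_of_tendsto hslope ?_
    filter_upwards [hev, hnear, eventually_mem_nhdsWithin] with s h1 h2 hs
    have hs' : (0 : ℝ) < s := hs
    have hne : z + s • w ≠ z := by
      intro h
      have h3 : s • w = 0 := by simpa using h
      rcases smul_eq_zero.1 h3 with h4 | h4
      · exact hs'.ne' h4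
      · rw [h4] at hw
        simp at hw
    have hmem : z + s • w ∈ Ω := by
      by_contra h
      have : z + s • w ∈ Metric.closedBall x R ∩ Ωᶜ := ⟨h1, h⟩
      rw [htouch] at this
      exact hne this
    have h5 := (hgraph _ h2).1.1 hmem
    rw [hTw] at h5
    have h6 : ζ ((T z).fst + s • (L w).fst) < (T z).snd + s * (L w).snd := by simpa using h5
    simp only [zero_add, zero_smul, add_zero, smul_eq_mul]
    rw [hz0, inv_mul_le_iff₀ hs']
    linarith
  linarith

theorem exists_isTouchingFrame (hΩ : IsC2Domain Ω) (hR : 0 < R) (hz : z ∈ frontier Ω)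
    (htouch : Metric.closedBall x R ∩ Ωᶜ = {z}) (hκ : IsPrincipalCurvatures Ω z κ)
    (hκR : ∀ j, κ j < 1 / R) :
    ∃ L : E N ≃ₗᵢ[ℝ] WithLp 2 (E (N - 1) × ℝ), IsTouchingFrame Ω x z R κ L := by
  obtain ⟨T, ζ, hT, h0, hH⟩ := hκ
  have hbelow := fun w => not_eventually_mem_closedBall (w := w) hT hz h0 htouch
  obtain ⟨hζ, r, hr, hgraph⟩ := hT
  set L := T.linearIsometryEquiv with hL
  have hTw : ∀ v : E N, T (z + v) = T z + L v := fun v => by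
    have := T.map_vadd z v
    rw [vadd_eq_add, vadd_eq_add, add_comm] at this
    rw [this, add_comm]
  have hz0 : ζ (T z).fst = (T z).snd := (hgraph z (Metric.mem_ball_self hr)).2.1 hz
  have hzball : z ∈ Metric.closedBall x R := by
    have : z ∈ Metric.closedBall x R ∩ Ωᶜ := by
      rw [htouch]
      exact mem_singleton z
    exact this.1
  set ν := frameNormal L with hν
  have hν1 : ‖ν‖ = 1 := norm_frameNormal L
  have hνν : inner ℝ ν ν = (1 : ℝ) := by rw [real_inner_self_eq_norm_sq, hν1, one_pow]
  have hsnd : ∀ w, (L w).snd = inner ℝ ν w := fun w => (inner_frameNormal L w).symm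
  -- the point `z` lies on the sphere
  have hnorm : ‖x - z‖ = R := by
    by_contra hne
    have hlt : ‖x - z‖ < R := by
      rw [Metric.mem_closedBall, dist_eq_norm, norm_sub_rev] at hzball
      exact lt_of_le_of_ne hzball hne
    refine hbelow (-ν) (by rw [hsnd, inner_neg_right, hνν]; norm_num) ?_
    have hc : Continuous fun s : ℝ => z + s • -ν := by fun_prop
    have := (hc.tendsto 0).mono_left (nhdsWithin_le_nhds (s := Ioi 0))
    simp only [zero_smul, add_zero] at this
    refine this.eventually (mem_of_superset (Metric.isOpen_ball.mem_nhds ?_)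
      Metric.ball_subset_closedBall)
    rwa [Metric.mem_ball, dist_eq_norm, norm_sub_rev]
  -- vectors pointing below the tangent plane point out of the ball
  have hhalf : ∀ w : E N, inner ℝ ν w < 0 → inner ℝ w (x - z) ≤ 0 := by
    intro w hw
    by_contra hpos
    push Not at hpos
    refine hbelow w (by rwa [hsnd]) ?_
    have hlim : Tendsto (fun s : ℝ => s * ‖w‖ ^ 2) (𝓝[>] 0) (𝓝 0) := by
      have hc : Continuous fun s : ℝ => s * ‖w‖ ^ 2 := by fun_prop
      simpa using (hc.tendsto 0).mono_left nhdsWithin_le_nhds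
    filter_upwards [hlim.eventually (gt_mem_nhds (by linarith : 0 < 2 * inner ℝ w (x - z))),
      eventually_mem_nhdsWithin] with s h1 hs
    have hs' : (0 : ℝ) < s := hs
    rw [Metric.mem_closedBall, dist_eq_norm, ← abs_of_pos hR, ← abs_norm, ← sq_le_sq]
    have h2 : z + s • w - x = s • w - (x - z) := by abel
    rw [h2, norm_sub_sq_real, norm_smul, inner_smul_left, hnorm, mul_pow, Real.norm_eq_abs, sq_abs]
    simp only [conj_trivial]
    nlinarith [mul_lt_mul_of_pos_left h1 hs']
  have hsub : x - z = R • ν := by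
    set d := x - z with hd
    set d' := d - (inner ℝ ν d) • ν with hd'
    have hνd' : inner ℝ ν d' = (0 : ℝ) := by
      rw [hd', inner_sub_right, inner_smul_right, hνν, mul_one, sub_self]
    have hd'd : inner ℝ d' d = ‖d'‖ ^ 2 := by
      have : d = d' + (inner ℝ ν d) • ν := by
        rw [hd']
        abel
      conv_lhs => rw [this]
      rw [inner_add_right, inner_smul_right, real_inner_self_eq_norm_sq, real_inner_comm ν d',
        hνd', mul_zero, add_zero]
    have hall : ∀ t : ℝ, t * ‖d'‖ ^ 2 ≤ inner ℝ ν d := by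
      intro t
      have h1 := hhalf (-ν + t • d') (by
        rw [inner_add_right, inner_neg_right, inner_smul_right, hνν, hνd']
        norm_num)
      rw [inner_add_left, inner_neg_left, real_inner_smul_left, hd'd] at h1
      linarith
    have hpos : 0 ≤ inner ℝ ν d := by simpa using hall 0
    have hzero : ‖d'‖ ^ 2 = 0 := by
      by_contra hne
      have h1 := hall ((inner ℝ ν d + 1) / ‖d'‖ ^ 2)
      rw [div_mul_cancel₀ _ hne] at h1
      linarith
    have h2 : d = (inner ℝ ν d) • ν := by
      have : d' = 0 := by simpa using hzero
      rwa [hd', sub_eq_zero] at this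
    have h3 : inner ℝ ν d = R := by
      rw [← hnorm, h2, norm_smul, hν1, mul_one, inner_smul_right, hνν, mul_one, Real.norm_eq_abs,
        abs_of_nonneg hpos]
    rwa [h3] at h2
  refine ⟨L, hΩ.1, hR, hsub, ?_, hκR, fun η hη => ?_⟩
  · rintro y ⟨hy, hyz⟩
    by_contra h
    have : y ∈ Metric.closedBall x R ∩ Ωᶜ := ⟨hy, h⟩
    rw [htouch] at this
    exact hyz this
  · obtain ⟨ρ, hρ, htaylor⟩ := exists_abs_sub_quadratic_le hζ h0 hH hη
    have hfst : ∀ w : E N, ‖(L w).fst‖ ^ 2 ≤ ‖w‖ ^ 2 := fun w => by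
      rw [norm_sq_eq_frame L w]
      linarith [sq_nonneg (L w).snd]
    have hexp : ∀ y ∈ Metric.closedBall z (min ρ (r / 2)),
        |ζ (T y).fst - (T z).snd - (∑ j, κ j * ((L (y - z)).fst j) ^ 2) / 2| ≤
          η * ‖y - z‖ ^ 2 ∧ (T y).snd = (T z).snd + (L (y - z)).snd ∧ y ∈ Metric.ball z r := by
      intro y hy
      rw [Metric.mem_closedBall, dist_eq_norm] at hy
      have h1 := hTw (y - z)
      rw [add_sub_cancel] at h1
      have h2 : (T y).fst = (T z).fst + (L (y - z)).fst := by rw [h1]; rfl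
      have h3 : (T y).snd = (T z).snd + (L (y - z)).snd := by rw [h1]; rfl
      have h4 : ‖(L (y - z)).fst‖ ≤ ‖y - z‖ :=
        le_of_sq_le_sq (hfst _) (norm_nonneg _)
      refine ⟨?_, h3, ?_⟩
      · rw [h2, ← hz0]
        exact (htaylor _ (h4.trans (hy.trans (min_le_left _ _)))).trans
          (mul_le_mul_of_nonneg_left (hfst _) hη.le)
      · rw [Metric.mem_ball, dist_eq_norm]
        have := hy.trans (min_le_right _ _)
        linarith
    have hpar : ∀ η y, paraboloid ν (frameTangent L) κ η z y =
        (L (y - z)).snd - (∑ j, κ j * ((L (y - z)).fst j) ^ 2) / 2 - η * ‖y - z‖ ^ 2 := by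
      intro η y
      have := paraboloid_frame L κ η z (y - z)
      rwa [add_sub_cancel] at this
    refine ⟨min ρ (r / 2), lt_min hρ (by positivity), fun y hy => ?_, fun y hy => ?_⟩
    · obtain ⟨h1, h2, h3⟩ := hexp y hy.2
      have h4 := (hgraph y h3).2.1 hy.1
      rw [hpar]
      linarith [(abs_le.1 h1).2]
    · obtain ⟨h1, h2, h3⟩ := hexp y hy.2
      have h4 : ζ (T y).fst ≤ (T y).snd := by
        by_cases hyΩ : y ∈ Ω
        · exact ((hgraph y h3).1.1 hyΩ).le
        · exact ((hgraph y h3).2.1 ⟨hy.1, by rwa [hΩ.1.interior_eq]⟩).le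
      rw [hpar]
      linarith [(abs_le.1 h1).1]

end Touching

/-! ### The limit of the `q`-means -/

theorem qMean_eq_of_isQMean {N : ℕ} {q : ℝ≥0∞} {u : E N → ℝ} {B : Set (E N)} {m : ℝ}
    (h : IsQMean q u B m) : qMean q u B = m := by
  have h1 : IsQMean q u B (qMean q u B) := Classical.epsilon_spec ⟨m, h⟩
  by_contra hne
  exact lt_asymm (h _ hne) (h1 _ (Ne.symm hne))

theorem rpow_add_two_div_two {y : ℝ} (hy : 0 < y) (n : ℕ) :
    y ^ (((n : ℝ) + 2) / 2) = √y ^ n * y := by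
  rw [show ((n : ℝ) + 2) / 2 = 1 / 2 * n + 1 by ring, Real.rpow_add_one hy.ne', Real.rpow_mul hy.le,
    Real.rpow_natCast, ← Real.sqrt_eq_rpow]

/-- The duplication formula for the two values of the gamma function that occur. -/
theorem Gamma_mul_Gamma_succ (n : ℕ) :
    Real.Gamma (((n : ℝ) + 2) / 2) * Real.Gamma (((n : ℝ) + 1) / 2 + 1) * 2 ^ (n + 1) =
      (n + 1).factorial * √Real.pi := by
  have h := Real.Gamma_mul_Gamma_add_half (((n : ℝ) + 2) / 2)
  have h1 : ((n : ℝ) + 2) / 2 + 1 / 2 = ((n : ℝ) + 1) / 2 + 1 := by ring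
  have h2 : 2 * (((n : ℝ) + 2) / 2) = ((n + 1 : ℕ) : ℝ) + 1 := by push_cast; ring
  rw [h1, h2, Real.Gamma_nat_eq_factorial] at h
  rw [h, show 1 - (((n + 1 : ℕ) : ℝ) + 1) = -((n + 1 : ℕ) : ℝ) by ring,
    Real.rpow_neg (by norm_num), Real.rpow_natCast]
  field_simp

theorem measureReal_ball {N : ℕ} (x : E N) {R : ℝ} (hR : 0 < R) :
    (volume.restrict (Metric.ball x R)).real univ =
      R ^ N * (√Real.pi ^ N / Real.Gamma ((N : ℝ) / 2 + 1)) := by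
  rw [measureReal_def, Measure.restrict_apply_univ]
  rcases Nat.eq_zero_or_pos N with rfl | hN
  · have : (Metric.ball x R) = univ := eq_univ_of_forall fun y => by
      rw [Subsingleton.elim y x]
      exact Metric.mem_ball_self hR
    rw [this, volume_euclideanSpace_eq_dirac]
    simp
  · have : Nonempty (Fin N) := ⟨⟨0, hN⟩⟩
    rw [EuclideanSpace.volume_ball, Fintype.card_fin, ENNReal.toReal_mul, ENNReal.toReal_pow,
      ENNReal.toReal_ofReal hR.le, ENNReal.toReal_ofReal]
    have : 0 < Real.Gamma ((N : ℝ) / 2 + 1) := Real.Gamma_pos_of_pos (by positivity)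
    positivity

theorem prod_sqrt_eq {n : ℕ} {R α c : ℝ} {κ : Fin n → ℝ} (hR : 0 < R) (hα : 0 < α) (hc : 0 < c)
    (hκ : ∀ j, κ j < 1 / R) :
    ∏ j, √(Real.pi / (α / (2 * c) * (1 / R - κ j))) =
      (√2 * √Real.pi * √c * √R / √α) ^ n / √(Pi0 R κ) := by
  have hpos : ∀ j, 0 < 1 - R * κ j := fun j => by
    have := hκ j
    rw [lt_div_iff₀ hR] at this
    linarith
  have h1 : ∀ j, √(Real.pi / (α / (2 * c) * (1 / R - κ j))) =
      √2 * √Real.pi * √c * √R / √α / √(1 - R * κ j) := by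
    intro j
    rw [← Real.sqrt_mul (by norm_num), ← Real.sqrt_mul (by positivity),
      ← Real.sqrt_mul (by positivity), ← Real.sqrt_div (by positivity),
      ← Real.sqrt_div (by positivity)]
    congr 1
    have h2 : 1 / R - κ j = (1 - R * κ j) / R := by field_simp
    have := hpos j
    rw [h2]
    field_simp
  have h3 : √(Pi0 R κ) = ∏ j, √(1 - R * κ j) := by
    rw [Pi0]
    exact Real.sqrt_prod _ fun j _ => (hpos j).le
  rw [Finset.prod_congr rfl fun j _ => h1 j, Finset.prod_div_distrib, h3,
    Finset.prod_const, Finset.card_univ, Fintype.card_fin]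

/-- The limit of `m^α` with the powers of `R` and `ε` scaled out, in closed form: the left side is the
integral of the profile divided by the volume of the ball. -/
theorem limit_constant_eq {n : ℕ} {R α θ : ℝ} {κ : Fin n → ℝ} (hR : 0 < R) (hα : 0 < α)
    (hθ : 0 < θ) (hκ : ∀ j, κ j < 1 / R) :
    R ^ (((n : ℝ) + 2) / 2) * (√θ / α * (∏ j, √(Real.pi / (α / (2 * √θ) * (1 / R - κ j)))) /
        (R ^ (n + 1) * (√Real.pi ^ (n + 1) / Real.Gamma (((n : ℝ) + 1) / 2 + 1)))) =
      (2 : ℝ) ^ (-(((n : ℝ) + 2) / 2)) * ((n + 1).factorial : ℝ) /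
        (α ^ (((n : ℝ) + 2) / 2) * Real.Gamma (((n : ℝ) + 2) / 2)) *
        (Pi0 R κ / θ ^ (((n : ℝ) + 2) / 2)) ^ (-(1 / 2) : ℝ) := by
  have hθ' : 0 < √θ := Real.sqrt_pos.2 hθ
  have hPi : 0 < Pi0 R κ := Finset.prod_pos fun j _ => by
    have := hκ j
    rw [lt_div_iff₀ hR] at this
    linarith
  have hθp : θ ^ (((n : ℝ) + 2) / 2) = (√(√θ) ^ n * √θ) ^ 2 := by
    rw [rpow_add_two_div_two hθ, mul_pow, ← pow_mul, mul_comm n 2, pow_mul, Real.sq_sqrt hθ'.le,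
      Real.sq_sqrt hθ.le]
  have hlast : (Pi0 R κ / θ ^ (((n : ℝ) + 2) / 2)) ^ (-(1 / 2) : ℝ) =
      √(√θ) ^ n * √θ / √(Pi0 R κ) := by
    rw [Real.rpow_neg (by positivity), ← Real.sqrt_eq_rpow, Real.sqrt_div hPi.le, hθp,
      Real.sqrt_sq (by positivity), inv_div]
  rw [hlast, prod_sqrt_eq hR hα hθ' hκ, rpow_add_two_div_two hR, Real.rpow_neg (by norm_num),
    rpow_add_two_div_two hα, rpow_add_two_div_two (by norm_num : (0 : ℝ) < 2)]
  have hG := Gamma_mul_Gamma_succ n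
  have hG1 : 0 < Real.Gamma (((n : ℝ) + 2) / 2) := Real.Gamma_pos_of_pos (by positivity)
  set G1 := Real.Gamma (((n : ℝ) + 2) / 2)
  set G2 := Real.Gamma (((n : ℝ) + 1) / 2 + 1)
  have hG2 : G2 = (n + 1).factorial * √Real.pi / (G1 * 2 ^ (n + 1)) := by
    rw [eq_div_iff (by positivity)]
    linarith
  have hRn : (R : ℝ) ^ n = √R ^ n * √R ^ n := by
    rw [← mul_pow, Real.mul_self_sqrt hR.le]
  have h2n : (2 : ℝ) ^ n = √2 ^ n * √2 ^ n := by
    rw [← mul_pow, Real.mul_self_sqrt (by norm_num)]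
  have hsR : 0 < √R := Real.sqrt_pos.2 hR
  have hsα : 0 < √α := Real.sqrt_pos.2 hα
  have hsπ : 0 < √Real.pi := Real.sqrt_pos.2 Real.pi_pos
  have hs2 : (0 : ℝ) < √2 := by positivity
  have hsPi : 0 < √(Pi0 R κ) := Real.sqrt_pos.2 hPi
  rw [hG2, pow_succ R, pow_succ (2 : ℝ), hRn, h2n, pow_succ (√Real.pi), div_pow, mul_pow, mul_pow,
    mul_pow]
  field_simp

theorem tendsto_exp_neg_div_rpow {k : ℝ} (hk : 0 < k) (p : ℝ) :
    Tendsto (fun ε : ℝ => Real.exp (-(k / ε)) / ε ^ p) (𝓝[>] 0) (𝓝 0) := by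
  have h := (tendsto_rpow_mul_exp_neg_mul_atTop_nhds_zero p k hk).comp
    (tendsto_inv_nhdsGT_zero (𝕜 := ℝ))
  refine h.congr' ?_
  filter_upwards [eventually_mem_nhdsWithin] with ε hε
  have hε' : (0 : ℝ) < ε := hε
  simp only [Function.comp_apply]
  rw [Real.inv_rpow hε'.le]
  simp only [div_eq_mul_inv, neg_mul]
  ring

section Final

variable {N : ℕ} {M : SymMat N → ℝ} {θ C R : ℝ} {Ω : Set (E N)} {u : ℝ → E N → ℝ} {x z : E N}

theorem IsTouchingFrame.aestronglyMeasurable {n : ℕ} {κ : Fin n → ℝ}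
    {L : E N ≃ₗᵢ[ℝ] WithLp 2 (E n × ℝ)} (hF : IsTouchingFrame Ω x z R κ L) {ε : ℝ} {v : E N → ℝ}
    (hv : IsSolution M ε Ω v) :
    AEStronglyMeasurable v (volume.restrict (Metric.ball x R)) :=
  (hv.continuousOn.mono (hF.ball_subset.trans subset_closure)).aestronglyMeasurable
    Metric.isOpen_ball.measurableSet

/-- In the touching ball the solutions vanish pointwise faster than any power of `ε`. -/
theorem eventually_le_rpow {n : ℕ} {κ : Fin n → ℝ} {L : E N ≃ₗᵢ[ℝ] WithLp 2 (E n × ℝ)}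
    (hM : IsRankOneStable θ C M) (hθ : 0 < θ) (hC : 0 ≤ C)
    (hu : ∀ ε > 0, IsSolution M ε Ω (u ε)) (hF : IsTouchingFrame Ω x z R κ L) (p : ℝ) {c : ℝ}
    (hc : 0 < c) {y : E N} (hy : y ∈ Metric.ball x R) :
    ∀ᶠ ε : ℝ in 𝓝[>] 0, u ε y ≤ c * ε ^ p := by
  obtain ⟨k, hk, hdecay⟩ := exists_exp_decay hM hθ hC hu hF
  have h1 := tendsto_exp_neg_div_rpow (mul_pos hk (hF.snd_pos hy)) p
  filter_upwards [hdecay, h1.eventually (gt_mem_nhds (by positivity : 0 < c / 2)),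
    eventually_mem_nhdsWithin] with ε h2 h3 hε
  have hε' : (0 : ℝ) < ε := hε
  rw [div_lt_iff₀ (Real.rpow_pos_of_pos hε' _)] at h3
  have h4 : k / ε * (L (y - z)).snd = k * (L (y - z)).snd / ε := by ring
  have h5 := h2 y hy
  rw [h4] at h5
  linarith

theorem restrict_ball_ne_zero (x : E N) (hR : 0 < R) :
    (volume.restrict (Metric.ball x R)) ≠ 0 := by
  rw [Ne, Measure.restrict_eq_zero]
  exact (Metric.measure_ball_pos volume x hR).ne'

theorem isFiniteMeasure_restrict_ball (x : E N) (R : ℝ) :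
    IsFiniteMeasure (volume.restrict (Metric.ball x R)) :=
  isFiniteMeasure_restrict.2 measure_ball_lt_top.ne

/-- The `q`-mean for finite `q`, for any operator that is stable on matrices of rank one. -/
theorem tendsto_qMean (hN : 1 ≤ N) {κ : Fin (N - 1) → ℝ}
    {L : E N ≃ₗᵢ[ℝ] WithLp 2 (E (N - 1) × ℝ)}
    (hM : IsRankOneStable θ C M) (hθ : 0 < θ) (hC : 0 ≤ C)
    (hu : ∀ ε > 0, IsSolution M ε Ω (u ε)) (hF : IsTouchingFrame Ω x z R κ L) {q : ℝ}
    (hq : 1 < q) :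
    Tendsto (fun ε : ℝ => (R / ε) ^ (((N : ℝ) + 1) / (2 * (q - 1))) *
        qMean (ENNReal.ofReal q) (u ε) (Metric.ball x R)) (𝓝[>] 0)
      (𝓝 (cNq N q * (Pi0 R κ / θ ^ (((N : ℝ) + 1) / 2)) ^ (-(1 / (2 * (q - 1)))))) := by
  obtain ⟨n, rfl⟩ : ∃ n, N = n + 1 := ⟨N - 1, by omega⟩
  change Fin n → ℝ at κ
  change E (n + 1) ≃ₗᵢ[ℝ] WithLp 2 (E n × ℝ) at L
  change IsTouchingFrame (n := n) Ω x z R κ L at hF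
  have hR := hF.pos
  have hfin := isFiniteMeasure_restrict_ball x R
  set α := q - 1 with hα'
  have hα : 0 < α := by linarith
  have hcast : (((n + 1 : ℕ) : ℝ) + 1) = (n : ℝ) + 2 := by push_cast; ring
  have h01 : ∀ ε > 0, ∀ᵐ y ∂(volume.restrict (Metric.ball x R)), u ε y ∈ Icc (0 : ℝ) 1 := by
    intro ε hε
    refine (ae_restrict_mem Metric.isOpen_ball.measurableSet).mono fun y hy => ?_
    have := subset_closure (hF.ball_subset hy)
    exact ⟨(hu ε hε).nonneg hM hC hF.isOpen this, (hu ε hε).le_one hM hC hF.isOpen this⟩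
  have hmean : ∀ ε > 0, 0 ≤ qMean (ENNReal.ofReal q) (u ε) (Metric.ball x R) ∧
      ∫ y in Metric.ball x R,
        signedPow α (qMean (ENNReal.ofReal q) (u ε) (Metric.ball x R) - u ε y) = 0 := by
    intro ε hε
    obtain ⟨m, hm, hm0⟩ := exists_integral_signedPow_eq_zero hα
      (hF.aestronglyMeasurable (hu ε hε)) (h01 ε hε)
    have : qMean (ENNReal.ofReal q) (u ε) (Metric.ball x R) = m :=
      qMean_eq_of_isQMean fun c hc => eLpNorm_sub_lt_of_integral_eq_zero
        (restrict_ball_ne_zero x hR) hq (hF.aestronglyMeasurable (hu ε hε)) (h01 ε hε) hm0 hc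
    rw [this]
    exact ⟨hm.1, hm0⟩
  have hw : ∀ ε : ℝ, 0 < ε → (√ε ^ n * ε) ^ (1 / α) = ε ^ (((n : ℝ) + 2) / (2 * α)) := by
    intro ε hε
    rw [← rpow_add_two_div_two hε, ← Real.rpow_mul hε.le]
    congr 1
    field_simp
  have hprof := integrable_profile hM hθ hC hu hF hα
  have hI0 : 0 ≤ ∫ p, profile R α (√θ) κ p :=
    integral_nonneg fun p => indicator_nonneg (fun _ _ => (Real.exp_pos _).le) p
  have hlim := tendsto_zero_div_rpow (μ := volume.restrict (Metric.ball x R))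
    (restrict_ball_ne_zero x hR) (l := 𝓝[>] (0 : ℝ)) (f := u) (w := fun ε => √ε ^ n * ε)
    (m := fun ε => qMean (ENNReal.ofReal q) (u ε) (Metric.ball x R)) hα
    (eventually_mem_nhdsWithin.mono fun ε hε => hF.aestronglyMeasurable (hu ε hε))
    (eventually_mem_nhdsWithin.mono fun ε hε => h01 ε hε)
    (eventually_mem_nhdsWithin.mono fun ε hε => by
      have hε' : (0 : ℝ) < ε := hε
      have := Real.sqrt_pos.2 hε'
      positivity)
    (tendsto_integral_rpow hM hθ hC hu hF hα) hI0
    (fun c hc => (ae_restrict_mem Metric.isOpen_ball.measurableSet).mono fun y hy => by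
      filter_upwards [eventually_le_rpow hM hθ hC hu hF (((n : ℝ) + 2) / (2 * α)) hc hy,
        eventually_mem_nhdsWithin] with ε h1 hε
      rwa [hw ε hε])
    (eventually_mem_nhdsWithin.mono fun ε hε => (hmean ε hε).1)
    (eventually_mem_nhdsWithin.mono fun ε hε => (hmean ε hε).2)
  have hconst : R ^ (((n : ℝ) + 2) / (2 * α)) * ((∫ p, profile R α (√θ) κ p) /
      (volume.restrict (Metric.ball x R)).real univ) ^ (1 / α) =
      cNq (n + 1) q * (Pi0 R κ / θ ^ (((n : ℝ) + 2) / 2)) ^ (-(1 / (2 * α))) := by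
    have hPi : 0 ≤ Pi0 R κ / θ ^ (((n : ℝ) + 2) / 2) := by
      refine div_nonneg (Finset.prod_nonneg fun j _ => ?_) (Real.rpow_nonneg hθ.le _)
      have := hF.curv_lt j
      rw [lt_div_iff₀ hR] at this
      linarith
    have hG1 : 0 < Real.Gamma (((n : ℝ) + 2) / 2) := Real.Gamma_pos_of_pos (by positivity)
    have e1 : R ^ (((n : ℝ) + 2) / (2 * α)) = (R ^ (((n : ℝ) + 2) / 2)) ^ (1 / α) := by
      rw [← Real.rpow_mul hR.le]
      congr 1
      field_simp
    have e2 : (Pi0 R κ / θ ^ (((n : ℝ) + 2) / 2)) ^ (-(1 / (2 * α))) =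
        ((Pi0 R κ / θ ^ (((n : ℝ) + 2) / 2)) ^ (-(1 / 2) : ℝ)) ^ (1 / α) := by
      rw [← Real.rpow_mul hPi]
      congr 1
      field_simp
    rw [e1, e2, cNq, hcast, ← hα', ← Real.mul_rpow (by positivity) (by positivity),
      ← Real.mul_rpow (by positivity) (by positivity), ← limit_constant_eq hR hα hθ hF.curv_lt,
      integral_profile hR hα (Real.sqrt_pos.2 hθ) hprof, measureReal_ball x hR]
    push_cast
    rfl
  rw [hcast]
  refine (hconst ▸ hlim.const_mul (R ^ (((n : ℝ) + 2) / (2 * α)))).congr' ?_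
  filter_upwards [eventually_mem_nhdsWithin] with ε hε
  have hε' : (0 : ℝ) < ε := hε
  rw [hw ε hε', Real.div_rpow hR.le hε'.le]
  ring

/-- The `∞`-mean of a solution is the midpoint of its range on the ball, as the supremum is one. -/
theorem isQMean_top (hzB : z ∈ closure (Metric.ball x R)) (hR : 0 < R) {v : E N → ℝ} {D : Set (E N)}
    (hD : Metric.ball x R ⊆ D) (hv : ContinuousOn v D) (hvz : v z = 1) (hzD : z ∈ D)
    (h01 : ∀ y ∈ Metric.ball x R, v y ∈ Icc (0 : ℝ) 1) :
    IsQMean ∞ v (Metric.ball x R) ((1 + sInf (v '' Metric.ball x R)) / 2) := by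
  set I := sInf (v '' Metric.ball x R) with hI
  have hne : (v '' Metric.ball x R).Nonempty := ⟨v x, x, Metric.mem_ball_self hR, rfl⟩
  have hbdd : BddBelow (v '' Metric.ball x R) := ⟨0, by
    rintro _ ⟨y, hy, rfl⟩
    exact (h01 y hy).1⟩
  have hIle : ∀ y ∈ Metric.ball x R, I ≤ v y := fun y hy => csInf_le hbdd ⟨y, hy, rfl⟩
  have hI1 : I ≤ 1 := (hIle x (Metric.mem_ball_self hR)).trans (h01 x (Metric.mem_ball_self hR)).2
  intro c hc
  have hupper : eLpNorm (fun y => v y - (1 + I) / 2) ∞ (volume.restrict (Metric.ball x R)) ≤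
      ENNReal.ofReal ((1 - I) / 2) := by
    rw [eLpNorm_exponent_top]
    refine eLpNormEssSup_le_of_ae_bound
      ((ae_restrict_mem Metric.isOpen_ball.measurableSet).mono fun y hy => ?_)
    rw [Real.norm_eq_abs, abs_le]
    constructor <;> linarith [hIle y hy, (h01 y hy).2]
  set d := |c - (1 + I) / 2| with hd
  have hd0 : 0 < d := abs_pos.2 (sub_ne_zero.2 hc)
  -- values of `v` close to one of the ends of its range are far from `c`
  have hfar : ∃ y ∈ Metric.ball x R, (1 - I) / 2 + d / 2 < |v y - c| := by
    rcases lt_or_gt_of_ne hc with hlt | hgt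
    · have hd' : d = (1 + I) / 2 - c := by rw [hd, abs_of_neg (by linarith)]; ring
      have hcz : Tendsto v (𝓝[Metric.ball x R] z) (𝓝 1) := by
        have := (hv z hzD).mono hD
        rw [ContinuousWithinAt, hvz] at this
        exact this
      have : (𝓝[Metric.ball x R] z).NeBot := mem_closure_iff_nhdsWithin_neBot.1 hzB
      obtain ⟨y, hy1, hy2⟩ := ((hcz.eventually (lt_mem_nhds (by linarith : 1 - d / 2 < 1))).and
        eventually_mem_nhdsWithin).exists
      refine ⟨y, hy2, lt_of_lt_of_le ?_ (le_abs_self _)⟩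
      linarith
    · have hd' : d = c - (1 + I) / 2 := by rw [hd, abs_of_pos (by linarith)]
      obtain ⟨_, ⟨y, hy, rfl⟩, hlt⟩ := exists_lt_of_csInf_lt hne
        (by linarith : sInf (v '' Metric.ball x R) < I + d / 2)
      refine ⟨y, hy, lt_of_lt_of_le ?_ (neg_le_abs _)⟩
      linarith
  have hlower : ENNReal.ofReal ((1 - I) / 2 + d / 2) ≤
      eLpNorm (fun y => v y - c) ∞ (volume.restrict (Metric.ball x R)) := by
    rw [eLpNorm_exponent_top]
    by_contra hlt
    push Not at hlt
    obtain ⟨y, hy, hyd⟩ := hfar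
    have hae := ae_lt_of_essSup_lt (f := fun y => ‖v y - c‖ₑ) hlt
    have hopen : IsOpen (Metric.ball x R ∩ (fun y => |v y - c|) ⁻¹' Ioi ((1 - I) / 2 + d / 2)) :=
      (((hv.mono hD).sub continuousOn_const).abs).isOpen_inter_preimage Metric.isOpen_ball
        isOpen_Ioi
    have hpos := hopen.measure_pos volume ⟨y, hy, hyd⟩
    rw [ae_restrict_iff' Metric.isOpen_ball.measurableSet, ae_iff] at hae
    refine hpos.ne' (measure_mono_null (fun w hw => ?_) hae)
    intro hcon
    have h1 := hcon hw.1
    rw [← ofReal_norm, ENNReal.ofReal_lt_ofReal_iff (by linarith)] at h1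
    exact lt_asymm h1 hw.2
  exact hupper.trans_lt (((ENNReal.ofReal_lt_ofReal_iff (by linarith)).2 (by linarith)).trans_le
    hlower)

/-- The supremum over the ball is one for every `ε`, because `z` is in its closure, and the infimum
tends to zero. -/
theorem tendsto_qMean_top {n : ℕ} {κ : Fin n → ℝ} {L : E N ≃ₗᵢ[ℝ] WithLp 2 (E n × ℝ)}
    (hM : IsRankOneStable θ C M) (hθ : 0 < θ) (hC : 0 ≤ C)
    (hu : ∀ ε > 0, IsSolution M ε Ω (u ε)) (hF : IsTouchingFrame Ω x z R κ L)
    (hz : z ∈ frontier Ω) :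
    Tendsto (fun ε : ℝ => qMean ∞ (u ε) (Metric.ball x R)) (𝓝[>] 0) (𝓝 (1 / 2)) := by
  have hR := hF.pos
  have hzB : z ∈ closure (Metric.ball x R) := by
    rw [closure_ball x hR.ne', Metric.mem_closedBall, dist_eq_norm, norm_sub_rev, hF.sub_eq,
      norm_smul, norm_frameNormal, mul_one, Real.norm_eq_abs, abs_of_pos hR]
  have hx : x ∈ Metric.ball x R := Metric.mem_ball_self hR
  have hcl : Metric.ball x R ⊆ closure Ω := hF.ball_subset.trans subset_closure
  have h01 : ∀ ε > 0, ∀ y ∈ Metric.ball x R, u ε y ∈ Icc (0 : ℝ) 1 := fun ε hε y hy =>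
    ⟨(hu ε hε).nonneg hM hC hF.isOpen (hcl hy), (hu ε hε).le_one hM hC hF.isOpen (hcl hy)⟩
  have hinf : Tendsto (fun ε : ℝ => sInf (u ε '' Metric.ball x R)) (𝓝[>] 0) (𝓝 0) := by
    have hup : Tendsto (fun ε : ℝ => 1 * ε ^ (1 : ℝ)) (𝓝[>] 0) (𝓝 0) := by
      simpa using tendsto_id_nhdsGT
    refine tendsto_of_tendsto_of_tendsto_of_le_of_le' tendsto_const_nhds hup ?_ ?_
    · filter_upwards [eventually_mem_nhdsWithin] with ε hε
      refine Real.sInf_nonneg ?_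
      rintro _ ⟨y, hy, rfl⟩
      exact (h01 ε hε y hy).1
    · filter_upwards [eventually_le_rpow hM hθ hC hu hF 1 one_pos hx, eventually_mem_nhdsWithin]
        with ε h1 hε
      refine (csInf_le (show BddBelow (u ε '' Metric.ball x R) from ⟨0, ?_⟩)
        ⟨x, hx, rfl⟩).trans h1
      rintro _ ⟨y, hy, rfl⟩
      exact (h01 ε hε y hy).1
  have hlim := (hinf.const_add 1).div_const 2
  rw [add_zero] at hlim
  refine hlim.congr' ?_
  filter_upwards [eventually_mem_nhdsWithin] with ε hε
  exact (qMean_eq_of_isQMean (isQMean_top hzB hR hcl (hu ε hε).continuousOn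
    ((hu ε hε).boundary z hz) (frontier_subset_closure hz) (h01 ε hε))).symm

end Final

theorem mainTheorem3 {N : ℕ} (hN : 1 ≤ N) {lam Lam : ℝ} (hlam : 0 < lam) (hLam : lam ≤ Lam)
    {Ω : Set (E N)} (hΩ : IsC2Domain Ω)
    {x z : E N} {R : ℝ} (hx : x ∈ Ω) (hR : 0 < R) (hz : z ∈ frontier Ω)
    (htouch : Metric.closedBall x R ∩ Ωᶜ = {z})
    {κ : Fin (N - 1) → ℝ} (hκ : IsPrincipalCurvatures Ω z κ) (hκR : ∀ j, κ j < 1 / R)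
    {uMinus uPlus : ℝ → E N → ℝ}
    (huMinus : ∀ ε > 0, IsSolution (pucciMinus lam Lam) ε Ω (uMinus ε))
    (huPlus : ∀ ε > 0, IsSolution (pucciPlus lam Lam) ε Ω (uPlus ε)) :
    (∀ q : ℝ, 1 < q →
      Tendsto (fun ε : ℝ => (R / ε) ^ (((N : ℝ) + 1) / (2 * (q - 1))) *
          qMean (ENNReal.ofReal q) (uMinus ε) (Metric.ball x R)) (𝓝[>] 0)
        (𝓝 (cNq N q *
          (Pi0 R κ / lam ^ (((N : ℝ) + 1) / 2)) ^ (-(1 / (2 * (q - 1))))))) ∧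
    (∀ q : ℝ, 1 < q →
      Tendsto (fun ε : ℝ => (R / ε) ^ (((N : ℝ) + 1) / (2 * (q - 1))) *
          qMean (ENNReal.ofReal q) (uPlus ε) (Metric.ball x R)) (𝓝[>] 0)
        (𝓝 (cNq N q *
          (Pi0 R κ / Lam ^ (((N : ℝ) + 1) / 2)) ^ (-(1 / (2 * (q - 1))))))) ∧
    Tendsto (fun ε : ℝ => qMean ∞ (uMinus ε) (Metric.ball x R)) (𝓝[>] 0) (𝓝 (1 / 2)) ∧
    Tendsto (fun ε : ℝ => qMean ∞ (uPlus ε) (Metric.ball x R)) (𝓝[>] 0) (𝓝 (1 / 2)) := by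
  have hLam0 : 0 < Lam := hlam.trans_le hLam
  have hC : 0 ≤ N * Lam := by positivity
  obtain ⟨L, hF⟩ := exists_isTouchingFrame hΩ hR hz htouch hκ hκR
  have hminus := pucciMinus_isRankOneStable (N := N) hlam hLam
  have hplus := pucciPlus_isRankOneStable (N := N) hlam hLam
  exact ⟨fun q hq => tendsto_qMean hN hminus hlam hC huMinus hF hq,
    fun q hq => tendsto_qMean hN hplus hLam0 hC huPlus hF hq,
    tendsto_qMean_top hminus hlam hC huMinus hF hz,
    tendsto_qMean_top hplus hLam0 hC huPlus hF hz⟩
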